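/- Let $b \ge 1$ be an integer, let $c \approx 1.764$ be the real root of $c = \exp(1/c)$, and let $q \ge 1 + \lceil cb \rceil$ be an integer. Let $G=(V,E)$ be the infinite $(b+1)$-regular tree (the Bethe lattice, or Cayley tree). A $q$-coloring of $G$ is a map $\sigma : V \to \{1,\dots,q\}$ with $\sigma(u) \ne \sigma(w)$ for every edge $\{u,w\}$. An infinite-volume Gibbs measure is a probability measure $p$ on the $q$-colorings of $G$ such that, for every finite $R \subseteq V$, the conditional distribution of $p$ given $\sigma|_{V\setminus R}$ is uniform on the $q$-colorings of $G$ that agree with $\sigma$ on $V \setminus R$. For $U \subseteq V$, $v \in V\setminus U$ and a $q$-coloring $\sigma$ of $G$, let $p_v^{\sigma_U}$ be the conditional distribution under $p$ of the color of $v$ given that the colors on $U$ are $\sigma_U = \sigma|_U$; for infinite $U$ this is the version of the regular conditional distribution given by the limit of the conditional distributions $p_v^{\sigma_F}$ over finite subsets $F \subseteq U$ (that this limit exists for every $\sigma$ and is such a version is part of the claim). Then there are constants $C, a > 0$, depending only on $b$ and $q$, such that every infinite-volume Gibbs measure $p$ on the $q$-colorings of $G$ has strong spatial mixing with rate $\delta(d)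 = C\exp(-a d)$: for every $U \subseteq V$, every $v \in V \setminus U$ and every pair of $q$-colorings $\sigma, \phi$ of $G$ that differ somewhere on $U$, $$\bigl\| p_v^{\sigma_U} - p_v^{\phi_U} \bigr\|_1 \le C \exp\bigl(-a\,\mathrm{dist}(v,\Delta)\bigr), \qquad \Delta = \{u \in U : \sigma(u) \neq \phi(u)\},$$ where $\mathrm{dist}(v,\Delta)$ is the smallest graph distance from $v$ to a vertex of $\Delta$. -/

import Mathlib

open MeasureTheory ProbabilityTheory Filter Topology
open scoped ENNReal

/-- A `q`-coloring of `G`: no edge is monochromatic. -/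
def IsProperColoring {V : Type*} (G : SimpleGraph V) {q : ℕ} (σ : V → Fin q) : Prop :=
  ∀ u w : V, G.Adj u w → σ u ≠ σ w

/-- The `q`-colorings of `G` that agree with `σ` outside the region `R`. -/
def coloringsAgreeingOff {V : Type*} (G : SimpleGraph V) {q : ℕ} (R : Finset V)
    (σ : V → Fin q) : Set (V → Fin q) :=
  {τ | IsProperColoring G τ ∧ ∀ u : V, u ∉ R → τ u = σ u}

/-- The probability of the event `A` when the colors in the finite region `R` are redrawn
uniformly among all choices that give a `q`-coloring of `G` with `σ` kept outside `R`. -/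
noncomputable def uniformInRegion {V : Type*} (G : SimpleGraph V) {q : ℕ} (R : Finset V)
    (σ : V → Fin q) (A : Set (V → Fin q)) : ℝ≥0∞ :=
  ((coloringsAgreeingOff G R σ ∩ A).ncard : ℝ≥0∞) / ((coloringsAgreeingOff G R σ).ncard : ℝ≥0∞)

/-- The restriction to `U` of an assignment of colors. -/
def restrictTo {V : Type*} {q : ℕ} (U : Set V) (σ : V → Fin q) : U → Fin q :=
  fun u => σ u

/-- The sigma-algebra generated by the colors outside the region `R`. -/
abbrev outsideSigmaAlgebra {V : Type*} (q : ℕ) (R : Finset V) : MeasurableSpace (V → Fin q) :=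
  MeasurableSpace.comap (restrictTo {u : V | u ∉ R}) inferInstance

/-- `p` is an infinite-volume Gibbs measure on the `q`-colorings of `G`: a probability measure
carried by the `q`-colorings such that, for every finite region `R`, the conditional distribution
given the colors outside `R` is the uniform distribution on the compatible colorings of `R`. -/
structure IsGibbsMeasure {V : Type*} (G : SimpleGraph V) {q : ℕ} (p : Measure (V → Fin q)) :
    Prop where
  isProbabilityMeasure : IsProbabilityMeasure p
  ae_proper : ∀ᵐ σ ∂p, IsProperColoring G σ
  conditional : ∀ (R : Finset V) (A B : Set (V → Fin q)), MeasurableSet A →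
    MeasurableSet[outsideSigmaAlgebra q R] B →
    p (A ∩ B) = ∫⁻ σ in B, uniformInRegion G R σ A ∂p

/-- The elementary conditional probability, under `p`, that `v` has color `c` given that the
colors on the finite set `F` of vertices of `U` are those of `σ`. -/
noncomputable def finiteCondProb {V : Type*} {q : ℕ} (p : Measure (V → Fin q)) (v : V)
    (U : Set V) (F : Finset U) (σ : V → Fin q) (c : Fin q) : ℝ :=
  (p[|{τ : V → Fin q | ∀ u ∈ F, τ (u : V) = σ u}]).real {τ | τ v = c}

/-- `κ` is the conditional distribution of the color of `v` given the colors on `U`.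
It is a regular conditional distribution. When `U` is infinite a single coloring of `U` may have
probability zero, and then a regular conditional distribution is determined only up to null sets;
the second condition fixes the value at every coloring of `U` (that is, at the restriction to `U`
of every `q`-coloring of `G`) as the limit of the elementary conditional probabilities
given the colors on finite subsets of `U`. For finite `U` this limit is the elementary conditional
probability given the colors on `U`. -/
structure IsConditionalMarginal {V : Type*} (G : SimpleGraph V) {q : ℕ}
    (p : Measure (V → Fin q)) (v : V) (U : Set V) (κ : Kernel (U → Fin q) (Fin q)) : Prop where
  isMarkov : IsMarkovKernel κ
  disintegration :
    (p.map (fun σ => restrictTo U σ)) ⊗ₘ κ = p.map (fun σ => (restrictTo U σ, σ v))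
  pointwise : ∀ σ : V → Fin q, IsProperColoring G σ → ∀ c : Fin q,
    Tendsto (fun F : Finset U => finiteCondProb p v U F σ c) atTop
      (𝓝 ((κ (restrictTo U σ)).real {c}))

/-- The set of vertices of `U` on which `σ` and `φ` differ. -/
def disagreement {V : Type*} {q : ℕ} (U : Set V) (σ φ : V → Fin q) : Set V :=
  {u | u ∈ U ∧ σ u ≠ φ u}

/-- The distance from `v` to a nonempty set of vertices (with value `0` at the empty set). -/
noncomputable def distToSet {V : Type*} (G : SimpleGraph V) (v : V) (D : Set V) : ℕ :=
  sInf (G.dist v '' D)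

/-- Strong spatial mixing of `p` with rate `δ`. Distributions on colors are compared in the
`ℓ¹` norm. If the two colorings of `U` coincide, the left side of the bound is `0`. -/
def StrongSpatialMixing {V : Type*} (G : SimpleGraph V) {q : ℕ} (p : Measure (V → Fin q))
    (δ : ℕ → ℝ) : Prop :=
  ∀ (v : V) (U : Set V), v ∉ U →
    ∃ κ : Kernel (U → Fin q) (Fin q), IsConditionalMarginal G p v U κ ∧
      ∀ σ φ : V → Fin q, IsProperColoring G σ → IsProperColoring G φ →
        ∑ c : Fin q, |(κ (restrictTo U σ)).real {c} - (κ (restrictTo U φ)).real {c}|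
          ≤ δ (distToSet G v (disagreement U σ φ))

/-! Once the edges at a vertex `v` of a forest are removed, the colors of its neighbors are
independent under the uniform coloring. So the marginal of `v` is proportional to `∏ (1 - x w c)`
over the neighbors `w`, where `x w` is the marginal of `w` after the cut (`vertexMarginal_eq`).

This recursion contracts the squared Hellinger distance. In the coordinates `a = √x` the map `a ↦ ∏
√(1 - a²)` has gradient of squared norm at most `e⁻¹ / (1 - r)²` where all `a² ≤ r`, because `∏ (1 -
x) * ∑ x ≤ e⁻¹`. With `b` children the total mass is at least `q - b`, so normalizing gains a factor
`1 / (q - b)`. A free child has marginals at most `r = 1 / (q - b)`; a pinned child carries the same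
point mass on both sides. The resulting factor `b / (q - b) * e⁻¹ / (1 - r)²` is at most `99/100`,
because `c ≥ 7/4`. Only the root can have `b + 1` children, and it costs a constant. Hence
finite-volume marginals whose boundary conditions agree within distance `d` differ by `O(θ ^ d)`
with `θ = √(99/100)`.

Under a Gibbs measure the conditional law of the color of `v` given finitely many colors is an
average of finite-volume marginals (`IsGibbsMeasure.cond_le`, `IsGibbsMeasure.le_cond`), so it obeys
the same bound. The decay makes these laws a Cauchy net over the finite subsets of `U`. The limit
inherits the bound, and dominated convergence on cylinders shows that it is a regular conditional
distribution. -/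

/-! ### Contraction of the sum-product map in Hellinger distance -/

/-- A Bernoulli-type inequality for products of factors in the unit interval. -/
theorem one_sub_sum_le_prod_one_sub {ι : Type*} (s : Finset ι) (x : ι → ℝ)
    (h0 : ∀ i ∈ s, 0 ≤ x i) (h1 : ∀ i ∈ s, x i ≤ 1) :
    1 - ∑ i ∈ s, x i ≤ ∏ i ∈ s, (1 - x i) := by
  classical
  induction s using Finset.induction_on with
  | empty => simp
  | insert a s ha ih =>
    rw [Finset.sum_insert ha, Finset.prod_insert ha]
    have ih' := ih (fun i hi => h0 i (Finset.mem_insert_of_mem hi))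
      (fun i hi => h1 i (Finset.mem_insert_of_mem hi))
    have a0 := h0 a (Finset.mem_insert_self a s)
    have a1 := h1 a (Finset.mem_insert_self a s)
    have hs : 0 ≤ ∑ i ∈ s, x i :=
      Finset.sum_nonneg fun i hi => h0 i (Finset.mem_insert_of_mem hi)
    nlinarith [mul_le_mul_of_nonneg_left ih' (sub_nonneg.2 a1), mul_nonneg a0 hs]

/-- A product form of the inequality `x e^{-x} ≤ e^{-1}`. -/
theorem prod_one_sub_mul_sum_le {ι : Type*} (s : Finset ι) (x : ι → ℝ)
    (h0 : ∀ i ∈ s, 0 ≤ x i) (h1 : ∀ i ∈ s, x i ≤ 1) :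
    (∏ i ∈ s, (1 - x i)) * ∑ i ∈ s, x i ≤ Real.exp (-1) := by
  have hp : ∏ i ∈ s, (1 - x i) ≤ Real.exp (-∑ i ∈ s, x i) := by
    rw [← Finset.sum_neg_distrib, Real.exp_sum]
    refine Finset.prod_le_prod (fun i hi => sub_nonneg.2 (h1 i hi)) fun i _ => ?_
    have := Real.add_one_le_exp (-x i)
    linarith
  calc (∏ i ∈ s, (1 - x i)) * ∑ i ∈ s, x i
      ≤ Real.exp (-∑ i ∈ s, x i) * ∑ i ∈ s, x i :=
        mul_le_mul_of_nonneg_right hp (Finset.sum_nonneg h0)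
    _ ≤ Real.exp (-1) := by
        rw [mul_comm]; exact Real.mul_exp_neg_le_exp_neg_one _

/-- Lipschitz estimate for `a ↦ ∏ √(1 - a i ^ 2)` on the cube `0 ≤ a i`, `a i ^ 2 ≤ r`. -/
theorem sq_prod_sqrt_sub_le {ι : Type*} (s : Finset ι) (a a' : ι → ℝ) (r : ℝ) (hr : r < 1)
    (ha : ∀ i ∈ s, 0 ≤ a i) (ha' : ∀ i ∈ s, 0 ≤ a' i)
    (har : ∀ i ∈ s, a i ^ 2 ≤ r) (har' : ∀ i ∈ s, a' i ^ 2 ≤ r) :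
    (∏ i ∈ s, √(1 - a' i ^ 2) - ∏ i ∈ s, √(1 - a i ^ 2)) ^ 2
      ≤ (1 / (1 - r)) ^ 2 * Real.exp (-1) * ∑ i ∈ s, (a i - a' i) ^ 2 := by
  classical
  -- Mean value inequality along the segment from `a` to `a'`, which stays in the region `y i ^ 2 ≤
  -- r` by convexity of the square.
  set y : ι → ℝ → ℝ := fun i t => a i + t * (a' i - a i) with hy
  set D : ℝ := ∑ i ∈ s, (a i - a' i) ^ 2 with hD
  have hD0 : 0 ≤ D := Finset.sum_nonneg fun i _ => sq_nonneg _
  have hr1 : 0 < 1 - r := by linarith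
  have hy0 : ∀ i ∈ s, ∀ t ∈ Set.Icc (0 : ℝ) 1, 0 ≤ y i t := by
    intro i hi t ht
    have : y i t = (1 - t) * a i + t * a' i := by simp only [hy]; ring
    rw [this]
    have := ha i hi; have := ha' i hi; have := ht.1; have := sub_nonneg.2 ht.2
    positivity
  have hyr : ∀ i ∈ s, ∀ t ∈ Set.Icc (0 : ℝ) 1, y i t ^ 2 ≤ r := by
    intro i hi t ht
    have : y i t ^ 2 = (1 - t) * a i ^ 2 + t * a' i ^ 2 - t * (1 - t) * (a' i - a i) ^ 2 := by
      simp only [hy]; ring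
    rw [this]
    have h1 := mul_le_mul_of_nonneg_left (har i hi) (sub_nonneg.2 ht.2)
    have h2 := mul_le_mul_of_nonneg_left (har' i hi) ht.1
    have h3 := mul_nonneg (mul_nonneg ht.1 (sub_nonneg.2 ht.2)) (sq_nonneg (a' i - a i))
    linarith
  have hderiv : ∀ i ∈ s, ∀ t ∈ Set.Icc (0 : ℝ) 1, HasDerivAt (fun t => √(1 - y i t ^ 2))
      (-(y i t * (a' i - a i)) / √(1 - y i t ^ 2)) t := by
    intro i hi t ht
    have h1 : HasDerivAt (fun t => y i t) (a' i - a i) t := by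
      simpa [hy] using ((hasDerivAt_id' t).mul_const (a' i - a i)).const_add (a i)
    have h2 := ((h1.pow 2).const_sub 1).sqrt (by have := hyr i hi t ht; simp; linarith)
    convert! h2 using 1
    simp only [Pi.pow_apply]
    field_simp
    push_cast
    ring
  have key : ∀ t ∈ Set.Icc (0 : ℝ) 1,
      ‖∑ i ∈ s, (∏ j ∈ s.erase i, √(1 - y j t ^ 2)) •
        (-(y i t * (a' i - a i)) / √(1 - y i t ^ 2))‖
        ≤ √((1 / (1 - r)) ^ 2 * Real.exp (-1) * D) := by
    intro t ht
    have hpos : ∀ i ∈ s, 1 - r ≤ 1 - y i t ^ 2 := fun i hi => by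
      linarith [hyr i hi t ht]
    set P : ℝ := ∏ j ∈ s, √(1 - y j t ^ 2) with hP
    have hP0 : 0 ≤ P := Finset.prod_nonneg fun _ _ => Real.sqrt_nonneg _
    have hP2 : P ^ 2 = ∏ j ∈ s, (1 - y j t ^ 2) := by
      rw [hP, ← Finset.prod_pow]
      exact Finset.prod_congr rfl fun i hi => Real.sq_sqrt (hr1.le.trans (hpos i hi))
    have hterm : ∀ i ∈ s, ‖(∏ j ∈ s.erase i, √(1 - y j t ^ 2)) •
        (-(y i t * (a' i - a i)) / √(1 - y i t ^ 2))‖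
          ≤ P * (1 / (1 - r)) * (y i t * |a i - a' i|) := by
      intro i hi
      have hs : 0 < √(1 - y i t ^ 2) := Real.sqrt_pos.2 (hr1.trans_le (hpos i hi))
      have e1 : (∏ j ∈ s.erase i, √(1 - y j t ^ 2)) = P / √(1 - y i t ^ 2) := by
        rw [eq_div_iff hs.ne', hP, Finset.prod_erase_mul _ _ hi]
      have e2 : √(1 - y i t ^ 2) * √(1 - y i t ^ 2) = 1 - y i t ^ 2 :=
        Real.mul_self_sqrt (hr1.le.trans (hpos i hi))
      have hpi := hr1.trans_le (hpos i hi)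
      rw [e1, smul_eq_mul, div_mul_div_comm, e2, norm_div, Real.norm_of_nonneg hpi.le,
        norm_mul, Real.norm_of_nonneg hP0, norm_neg, norm_mul,
        Real.norm_of_nonneg (hy0 i hi t ht), Real.norm_eq_abs, abs_sub_comm,
        div_eq_mul_one_div]
      have : 1 / (1 - y i t ^ 2) ≤ 1 / (1 - r) := one_div_le_one_div_of_le hr1 (hpos i hi)
      have hn : 0 ≤ P * (y i t * |a i - a' i|) :=
        mul_nonneg hP0 (mul_nonneg (hy0 i hi t ht) (abs_nonneg _))
      nlinarith [mul_le_mul_of_nonneg_left this hn]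
    refine (norm_sum_le_of_le s hterm).trans ?_
    rw [← Finset.mul_sum]
    refine Real.le_sqrt_of_sq_le ?_
    -- Cauchy–Schwarz separates the displacement `D` from `∑ y ^ 2`, and the latter is absorbed by
    -- `P ^ 2` through `x e^{-x} ≤ e^{-1}`.
    have hcs : (∑ i ∈ s, y i t * |a i - a' i|) ^ 2 ≤ (∑ i ∈ s, y i t ^ 2) * D := by
      have := Finset.sum_mul_sq_le_sq_mul_sq s (fun i => y i t) (fun i => |a i - a' i|)
      simpa only [sq_abs] using this
    have hpe := prod_one_sub_mul_sum_le s (fun i => y i t ^ 2) (fun i _ => sq_nonneg _)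
      (fun i hi => by linarith [hyr i hi t ht])
    calc (P * (1 / (1 - r)) * ∑ i ∈ s, y i t * |a i - a' i|) ^ 2
        = (1 / (1 - r)) ^ 2 * (P ^ 2 * (∑ i ∈ s, y i t * |a i - a' i|) ^ 2) := by ring
      _ ≤ (1 / (1 - r)) ^ 2 * (P ^ 2 * ((∑ i ∈ s, y i t ^ 2) * D)) := by gcongr
      _ = (1 / (1 - r)) ^ 2 * ((P ^ 2 * (∑ i ∈ s, y i t ^ 2)) * D) := by ring
      _ ≤ (1 / (1 - r)) ^ 2 * (Real.exp (-1) * D) := by rw [hP2]; gcongr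
      _ = _ := by ring
  have hmv := norm_image_sub_le_of_norm_deriv_le_segment_01'
    (f := fun t => ∏ i ∈ s, √(1 - y i t ^ 2))
    (fun t ht => (HasDerivAt.fun_finsetProd fun i hi => hderiv i hi t ht).hasDerivWithinAt)
    (fun t ht => key t ⟨ht.1, ht.2.le⟩)
  have e0 : ∀ i, y i 0 = a i := fun i => by simp [hy]
  have e1 : ∀ i, y i 1 = a' i := fun i => by simp [hy]
  simp only [e0, e1, Real.norm_eq_abs] at hmv
  rw [← sq_abs]
  calc _ ≤ (√((1 / (1 - r)) ^ 2 * Real.exp (-1) * D)) ^ 2 := by gcongr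
    _ = _ := Real.sq_sqrt (by positivity)

/-- The estimate of `sq_prod_sqrt_sub_le` when some of the factors coincide. -/
theorem sq_sqrt_prod_sub_le {ι : Type*} (s : Finset ι) (x x' : ι → ℝ) (r : ℝ) (hr : r < 1)
    (h0 : ∀ i ∈ s, 0 ≤ x i) (h0' : ∀ i ∈ s, 0 ≤ x' i) (h1 : ∀ i ∈ s, x i ≤ 1)
    (h1' : ∀ i ∈ s, x' i ≤ 1) (h : ∀ i ∈ s, x i = x' i ∨ (x i ≤ r ∧ x' i ≤ r)) :
    (√(∏ i ∈ s, (1 - x i)) - √(∏ i ∈ s, (1 - x' i))) ^ 2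
      ≤ (1 / (1 - r)) ^ 2 * Real.exp (-1) * ∑ i ∈ s, (√(x i) - √(x' i)) ^ 2 := by
  classical
  rw [Real.sqrt_prod s (fun i hi => sub_nonneg.2 (h1 i hi)),
    Real.sqrt_prod s (fun i hi => sub_nonneg.2 (h1' i hi)),
    ← Finset.prod_filter_mul_prod_filter_not s (fun i => x i = x' i),
    ← Finset.prod_filter_mul_prod_filter_not s (fun i => x i = x' i) (fun i => √(1 - x' i))]
  -- The coinciding factors come out as a common factor in `[0, 1]`, so no bound by `r` is needed
  -- for them.
  have e : ∏ i ∈ s with x i = x' i, √(1 - x' i) = ∏ i ∈ s with x i = x' i, √(1 - x i) :=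
    Finset.prod_congr rfl fun i hi => by rw [(Finset.mem_filter.1 hi).2]
  rw [e, ← mul_sub, mul_pow]
  have hc0 : 0 ≤ ∏ i ∈ s with x i = x' i, √(1 - x i) :=
    Finset.prod_nonneg fun _ _ => Real.sqrt_nonneg _
  have hc1 : ∏ i ∈ s with x i = x' i, √(1 - x i) ≤ 1 :=
    Finset.prod_le_one (fun _ _ => Real.sqrt_nonneg _) fun i hi => by
      refine Real.sqrt_le_one.2 ?_
      linarith [h0 i (Finset.mem_filter.1 hi).1]
  set t := s.filter fun i => ¬ x i = x' i with ht
  have hts : t ⊆ s := Finset.filter_subset _ _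
  have hsq : ∀ i ∈ t, √(x i) ^ 2 = x i := fun i hi => Real.sq_sqrt (h0 i (hts hi))
  have hsq' : ∀ i ∈ t, √(x' i) ^ 2 = x' i := fun i hi => Real.sq_sqrt (h0' i (hts hi))
  have hle : ∀ i ∈ t, x i ≤ r ∧ x' i ≤ r := fun i hi =>
    (h i (hts hi)).resolve_left (Finset.mem_filter.1 hi).2
  have hm := sq_prod_sqrt_sub_le t (fun i => √(x' i)) (fun i => √(x i)) r hr
    (fun _ _ => Real.sqrt_nonneg _) (fun _ _ => Real.sqrt_nonneg _)
    (fun i hi => by rw [hsq' i hi]; exact (hle i hi).2)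
    (fun i hi => by rw [hsq i hi]; exact (hle i hi).1)
  have ep : ∏ i ∈ t, √(1 - √(x i) ^ 2) = ∏ i ∈ t, √(1 - x i) :=
    Finset.prod_congr rfl fun i hi => by rw [hsq i hi]
  have ep' : ∏ i ∈ t, √(1 - √(x' i) ^ 2) = ∏ i ∈ t, √(1 - x' i) :=
    Finset.prod_congr rfl fun i hi => by rw [hsq' i hi]
  rw [ep, ep'] at hm
  have hsum : ∑ i ∈ t, (√(x' i) - √(x i)) ^ 2 ≤ ∑ i ∈ s, (√(x i) - √(x' i)) ^ 2 := by
    simp only [sub_sq_comm (√(x' _))]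
    exact Finset.sum_le_sum_of_subset_of_nonneg hts fun _ _ _ => sq_nonneg _
  calc _ ≤ 1 * (∏ i ∈ t, √(1 - x i) - ∏ i ∈ t, √(1 - x' i)) ^ 2 := by
        gcongr
        exact pow_le_one₀ hc0 hc1
    _ ≤ _ := by
        rw [one_mul]
        refine hm.trans ?_
        gcongr

/-- Normalizing two nonnegative vectors of mass at least `m` contracts the Hellinger distance
by `1 / m`. -/
theorem hellinger_normalize_le {κ : Type*} [Fintype κ] (P P' : κ → ℝ) (m : ℝ) (hm : 0 < m)
    (hP : ∀ c, 0 ≤ P c) (hP' : ∀ c, 0 ≤ P' c) (hZ : m ≤ ∑ c, P c) (hZ' : m ≤ ∑ c, P' c) :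
    ∑ c, (√(P c / ∑ c', P c') - √(P' c / ∑ c', P' c')) ^ 2
      ≤ 1 / m * ∑ c, (√(P c) - √(P' c)) ^ 2 := by
  set Z := ∑ c, P c with hZd
  set Z' := ∑ c, P' c with hZd'
  have hA : 0 < √Z := Real.sqrt_pos.2 (hm.trans_le hZ)
  have hB : 0 < √Z' := Real.sqrt_pos.2 (hm.trans_le hZ')
  have hA2 : √Z ^ 2 = Z := Real.sq_sqrt (hm.le.trans hZ)
  have hB2 : √Z' ^ 2 = Z' := Real.sq_sqrt (hm.le.trans hZ')
  set I := ∑ c, √(P c) * √(P' c) with hI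
  have h1 : ∑ c, (√(P c) - √(P' c)) ^ 2 = Z + Z' - 2 * I := by
    rw [hZd, hZd', hI, Finset.mul_sum, ← Finset.sum_add_distrib, ← Finset.sum_sub_distrib]
    refine Finset.sum_congr rfl fun c _ => ?_
    rw [sub_sq, Real.sq_sqrt (hP c), Real.sq_sqrt (hP' c)]; ring
  have h2 : ∑ c, (√(P c / Z) - √(P' c / Z')) ^ 2 = 2 - 2 * I / (√Z * √Z') := by
    have : ∀ c, (√(P c / Z) - √(P' c / Z')) ^ 2
        = P c / Z + P' c / Z' - 2 * (√(P c) * √(P' c)) / (√Z * √Z') := by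
      intro c
      rw [Real.sqrt_div (hP c), Real.sqrt_div (hP' c), sub_sq, div_pow, div_pow, hA2, hB2,
        Real.sq_sqrt (hP c), Real.sq_sqrt (hP' c)]
      field_simp
      ring
    simp only [this]
    rw [Finset.sum_sub_distrib, Finset.sum_add_distrib, ← Finset.sum_div, ← Finset.sum_div,
      ← Finset.sum_div, ← Finset.mul_sum, ← hZd, ← hZd', ← hI,
      div_self (hm.trans_le hZ).ne', div_self (hm.trans_le hZ').ne']
    ring
  have hnn : 0 ≤ Z + Z' - 2 * I := h1 ▸ Finset.sum_nonneg fun _ _ => sq_nonneg _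
  have hAB : m ≤ √Z * √Z' := by
    rw [← Real.sqrt_mul (hm.le.trans hZ)]
    exact Real.le_sqrt_of_sq_le (by nlinarith)
  rw [h1, h2]
  -- The two sides differ by the nonnegative quantity `(√Z - √Z')² / (√Z √Z')`.
  calc 2 - 2 * I / (√Z * √Z') ≤ 1 / (√Z * √Z') * (Z + Z' - 2 * I) := by
        have : 1 / (√Z * √Z') * (Z + Z' - 2 * I) - (2 - 2 * I / (√Z * √Z'))
            = (√Z - √Z') ^ 2 / (√Z * √Z') := by
          rw [sub_sq, hA2, hB2]
          field_simp
          ring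
        have h3 : 0 ≤ (√Z - √Z') ^ 2 / (√Z * √Z') := by positivity
        linarith
    _ ≤ _ := by gcongr

/-- The partition function at a vertex with `s.card` neighbors. -/
theorem card_sub_le_sum_prod {ι κ : Type*} [Fintype κ] (s : Finset ι) (x : ι → κ → ℝ)
    (h0 : ∀ i ∈ s, ∀ c, 0 ≤ x i c) (h1 : ∀ i ∈ s, ∑ c, x i c = 1) :
    (Fintype.card κ : ℝ) - s.card ≤ ∑ c, ∏ i ∈ s, (1 - x i c) := by
  have hle : ∀ i ∈ s, ∀ c, x i c ≤ 1 := fun i hi c =>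
    h1 i hi ▸ Finset.single_le_sum (fun c' _ => h0 i hi c') (Finset.mem_univ c)
  calc (Fintype.card κ : ℝ) - s.card = ∑ c, (1 - ∑ i ∈ s, x i c) := by
        rw [Finset.sum_sub_distrib, Finset.sum_comm, Finset.sum_congr rfl h1]
        simp
    _ ≤ _ := Finset.sum_le_sum fun c _ => one_sub_sum_le_prod_one_sub s _
        (fun i hi => h0 i hi c) (fun i hi => hle i hi c)

/-- One step of the sum-product recursion in Hellinger distance. -/
theorem hellinger_sum_product_le {ι κ : Type*} [Fintype κ] (s : Finset ι)
    (x x' : ι → κ → ℝ) (r m : ℝ) (hr : r < 1) (hm : 0 < m)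
    (hsm : m + s.card ≤ (Fintype.card κ : ℝ))
    (h0 : ∀ i ∈ s, ∀ c, 0 ≤ x i c) (h0' : ∀ i ∈ s, ∀ c, 0 ≤ x' i c)
    (h1 : ∀ i ∈ s, ∑ c, x i c = 1) (h1' : ∀ i ∈ s, ∑ c, x' i c = 1)
    (h : ∀ i ∈ s, x i = x' i ∨ ∀ c, x i c ≤ r ∧ x' i c ≤ r) :
    ∑ c, (√((∏ i ∈ s, (1 - x i c)) / ∑ c', ∏ i ∈ s, (1 - x i c'))
        - √((∏ i ∈ s, (1 - x' i c)) / ∑ c', ∏ i ∈ s, (1 - x' i c'))) ^ 2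
      ≤ 1 / m * ((1 / (1 - r)) ^ 2 * Real.exp (-1)) *
        ∑ i ∈ s, ∑ c, (√(x i c) - √(x' i c)) ^ 2 := by
  have hle : ∀ i ∈ s, ∀ c, x i c ≤ 1 := fun i hi c =>
    h1 i hi ▸ Finset.single_le_sum (fun c' _ => h0 i hi c') (Finset.mem_univ c)
  have hle' : ∀ i ∈ s, ∀ c, x' i c ≤ 1 := fun i hi c =>
    h1' i hi ▸ Finset.single_le_sum (fun c' _ => h0' i hi c') (Finset.mem_univ c)
  refine (hellinger_normalize_le (fun c => ∏ i ∈ s, (1 - x i c))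
    (fun c => ∏ i ∈ s, (1 - x' i c)) m hm
    (fun c => Finset.prod_nonneg fun i hi => sub_nonneg.2 (hle i hi c))
    (fun c => Finset.prod_nonneg fun i hi => sub_nonneg.2 (hle' i hi c))
    (by linarith [card_sub_le_sum_prod s x h0 h1])
    (by linarith [card_sub_le_sum_prod s x' h0' h1'])).trans ?_
  rw [mul_assoc, Finset.sum_comm, Finset.mul_sum (a := (1 / (1 - r)) ^ 2 * Real.exp (-1))]
  gcongr with c
  refine sq_sqrt_prod_sub_le s (fun i => x i c) (fun i => x' i c) r hr
    (fun i hi => h0 i hi c) (fun i hi => h0' i hi c) (fun i hi => hle i hi c)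
    (fun i hi => hle' i hi c) fun i hi => ?_
  rcases h i hi with e | e
  · left; rw [e]
  · right; exact e c

/-! ### Numerical constants -/

/-- The contraction factor of the recursion. -/
theorem contraction_factor_le (b q : ℕ) (hb : 1 ≤ b) (hq : 7 * b + 4 ≤ 4 * q) :
    (b : ℝ) * (1 / ((q : ℝ) - b) *
      ((1 / (1 - 1 / ((q : ℝ) - b))) ^ 2 * Real.exp (-1))) ≤ 99 / 100 := by
  have hb' : (1 : ℝ) ≤ b := by exact_mod_cast hb
  have hq' : 7 * (b : ℝ) + 4 ≤ 4 * q := by exact_mod_cast hq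
  have hn2 : (2 : ℝ) ≤ (q : ℝ) - b := by
    have : b + 2 ≤ q := by omega
    have : (b : ℝ) + 2 ≤ q := by exact_mod_cast this
    linarith
  generalize hn : (q : ℝ) - b = n at *
  -- With `n = q - b` the factor is `b n / ((n - 1)² e)`. The bound `b ≤ 4 (n - 1) / 3` and `n / (n
  -- - 1) ≤ 2` leave `8 / (3 e) < 0.982`.
  have hbn : 3 * (b : ℝ) ≤ 4 * (n - 1) := by linarith
  have he := Real.exp_one_gt_d9
  have hn1 : 0 < n - 1 := by linarith
  have e1 : (b : ℝ) * (1 / n * ((1 / (1 - 1 / n)) ^ 2 * Real.exp (-1)))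
      = b * n / ((n - 1) ^ 2 * Real.exp 1) := by
    rw [Real.exp_neg]
    have : (1 : ℝ) - 1 / n = (n - 1) / n := by field_simp
    rw [this]
    field_simp
  rw [e1, div_le_iff₀ (by positivity)]
  have h2 : (2.7182 : ℝ) * (n - 1) ^ 2 ≤ (n - 1) ^ 2 * Real.exp 1 := by nlinarith [sq_nonneg (n - 1)]
  nlinarith [mul_le_mul_of_nonneg_right hbn (by linarith : (0 : ℝ) ≤ n)]

/-- A solution of `c = exp (1 / c)` is at least `7 / 4`. -/
theorem seven_quarters_le_of_eq_exp_inv (c : ℝ) (hc : c = Real.exp (1 / c)) : 7 / 4 ≤ c := by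
  have hpos : 0 < c := hc ▸ Real.exp_pos _
  by_contra! hlt
  have h1 : (4 : ℝ) / 7 ≤ 1 / c := by
    rw [le_div_iff₀ hpos]; linarith
  -- Four terms of the exponential series at `4/7` already exceed `7/4`.
  have h2 := Real.sum_le_exp_of_nonneg (x := 4 / 7) (by norm_num) 4
  have h3 := Real.exp_le_exp.2 h1
  rw [← hc] at h3
  norm_num [Finset.sum_range_succ, Nat.factorial] at h2
  linarith

/-! ### Counting colorings and independence across components -/

theorem finite_coloringsAgreeingOff {V : Type*} (G : SimpleGraph V) {q : ℕ} (W : Finset V)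
    (η : V → Fin q) : (coloringsAgreeingOff G W η).Finite := by
  refine Set.Finite.of_finite_image (f := fun τ (u : W) => τ u) (Set.toFinite _) ?_
  intro τ hτ τ' hτ' h
  funext u
  by_cases hu : u ∈ W
  · exact congrFun h ⟨u, hu⟩
  · rw [hτ.2 u hu, hτ'.2 u hu]

theorem self_mem_coloringsAgreeingOff {V : Type*} {G : SimpleGraph V} {q : ℕ} (W : Finset V)
    {η : V → Fin q} (hη : IsProperColoring G η) : η ∈ coloringsAgreeingOff G W η :=
  ⟨hη, fun _ _ => rfl⟩

theorem ncard_coloringsAgreeingOff_pos {V : Type*} {G : SimpleGraph V} {q : ℕ} (W : Finset V)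
    {η : V → Fin q} (hη : IsProperColoring G η) : 0 < (coloringsAgreeingOff G W η).ncard :=
  (Set.ncard_pos (finite_coloringsAgreeingOff G W η)).2 ⟨η, self_mem_coloringsAgreeingOff W hη⟩

theorem Set.Finite.ncard_eq_sum_inter_eq {V : Type*} {q : ℕ} {S : Set (V → Fin q)}
    (hS : S.Finite) (v : V) : S.ncard = ∑ c : Fin q, (S ∩ {τ | τ v = c}).ncard := by
  classical
  rw [Set.ncard_eq_toFinset_card S hS,
    Finset.card_eq_sum_card_fiberwise (f := fun τ => τ v) (t := Finset.univ) (by simp)]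
  refine Finset.sum_congr rfl fun c _ => ?_
  rw [← Set.ncard_coe_finset]
  congr 1
  ext τ
  simp

/-- Events living on complementary unions of components are independent under the uniform
distribution on colorings. -/
theorem ncard_inter_mul_ncard {V : Type*} {H : SimpleGraph V} {q : ℕ} {W : Finset V}
    {η : V → Fin q} {A : Set V} (hA : ∀ a b, H.Adj a b → (a ∈ A ↔ b ∈ A))
    {X Y : Set (V → Fin q)}
    (hX : ∀ τ τ' : V → Fin q, (∀ u ∉ A, τ u = τ' u) → τ ∈ X → τ' ∈ X)
    (hY : ∀ τ τ' : V → Fin q, (∀ u ∈ A, τ u = τ' u) → τ ∈ Y → τ' ∈ Y) :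
    (coloringsAgreeingOff H W η ∩ (X ∩ Y)).ncard * (coloringsAgreeingOff H W η).ncard
      = (coloringsAgreeingOff H W η ∩ X).ncard * (coloringsAgreeingOff H W η ∩ Y).ncard := by
  classical
  set S := coloringsAgreeingOff H W η with hS
  -- Exchanging two colorings on `A` preserves `S × S`, since no edge leaves `A`. It is an
  -- involution carrying `(S ∩ (X ∩ Y)) × S` onto `(S ∩ X) × (S ∩ Y)`.
  let f : (V → Fin q) × (V → Fin q) → (V → Fin q) × (V → Fin q) :=
    fun z => (A.piecewise z.2 z.1, A.piecewise z.1 z.2)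
  have hf : Function.Involutive f := by
    rintro ⟨τ, τ'⟩
    ext u <;> by_cases hu : u ∈ A <;> simp [f, hu]
  have hpw : ∀ τ ∈ S, ∀ τ' ∈ S, A.piecewise τ τ' ∈ S := by
    rintro τ ⟨hp, ho⟩ τ' ⟨hp', ho'⟩
    refine ⟨fun u w huw => ?_, fun u hu => ?_⟩
    · by_cases hu : u ∈ A
      · simpa [hu, (hA u w huw).1 hu] using hp u w huw
      · have hw : w ∉ A := fun h => hu ((hA u w huw).2 h)
        simpa [hu, hw] using hp' u w huw
    · by_cases h : u ∈ A
      · simpa [h] using ho u hu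
      · simpa [h] using ho' u hu
  have hS2 : ∀ τ τ', A.piecewise τ' τ ∈ S → A.piecewise τ τ' ∈ S → τ ∈ S ∧ τ' ∈ S := by
    intro τ τ' h h'
    have e := hf (τ, τ')
    simp only [f, Prod.mk.injEq] at e
    exact ⟨e.1 ▸ hpw _ h' _ h, e.2 ▸ hpw _ h _ h'⟩
  rw [← Set.ncard_prod, ← Set.ncard_prod, ← Set.ncard_image_of_injective _ hf.injective]
  congr 1
  rw [hf.image_eq_preimage_symm]
  ext ⟨τ, τ'⟩
  simp only [f, Set.mem_preimage, Set.mem_prod, Set.mem_inter_iff]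
  constructor
  · rintro ⟨⟨h1, h2, h3⟩, h4⟩
    obtain ⟨h5, h6⟩ := hS2 τ τ' h1 h4
    exact ⟨⟨h5, hX _ _ (fun u hu => by simp [hu]) h2⟩, h6, hY _ _ (fun u hu => by simp [hu]) h3⟩
  · rintro ⟨⟨h1, h2⟩, h3, h4⟩
    exact ⟨⟨hpw _ h3 _ h1, hX _ _ (fun u hu => by simp [hu]) h2,
      hY _ _ (fun u hu => by simp [hu]) h4⟩, hpw _ h1 _ h3⟩

/-! ### The sum-product recursion on a forest -/

/-- The graph `H` with all the edges at `v` removed. -/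
def isolate {V : Type*} (H : SimpleGraph V) (v : V) : SimpleGraph V where
  Adj a b := H.Adj a b ∧ a ≠ v ∧ b ≠ v
  symm := ⟨fun _ _ h => ⟨h.1.symm, h.2.2, h.2.1⟩⟩
  loopless := ⟨fun _ h => H.loopless.irrefl _ h.1⟩

theorem isolate_le {V : Type*} (H : SimpleGraph V) (v : V) : isolate H v ≤ H :=
  fun _ _ h => h.1

theorem not_reachable_isolate {V : Type*} {H : SimpleGraph V} {v w : V} (hw : w ≠ v) :
    ¬ (isolate H v).Reachable w v := by
  rintro ⟨p⟩
  cases h : p.reverse with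
  | nil => exact hw rfl
  | cons h' _ => exact h'.2.1 rfl

/-- Distinct neighbors of `v` in a forest are separated by `v`. -/
theorem SimpleGraph.IsAcyclic.not_reachable_isolate {V : Type*} {H : SimpleGraph V}
    (hH : H.IsAcyclic) {v w w' : V} (hw : H.Adj v w) (hw' : H.Adj v w') (hne : w ≠ w') :
    ¬ (isolate H v).Reachable w w' := by
  intro hr
  have hb : H.IsBridge s(v, w) := SimpleGraph.isAcyclic_iff_forall_isBridge.1 hH hw
  rw [SimpleGraph.isBridge_iff] at hb
  have hle : isolate H v ≤ H.deleteEdges {s(v, w)} := by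
    intro a b hab
    rw [SimpleGraph.deleteEdges_adj]
    refine ⟨hab.1, ?_⟩
    simp only [Set.mem_singleton_iff, Sym2.eq_iff, not_or, not_and]
    exact ⟨fun h => absurd h hab.2.1, fun _ h => hab.2.2 h⟩
  -- A connection from `w` to `w'` avoiding `v`, closed up by the edge `v w'`, would bypass the
  -- bridge `v w`.
  refine hb (SimpleGraph.Reachable.trans (SimpleGraph.Adj.reachable (v := w') ?_)
    (hr.mono hle).symm)
  rw [SimpleGraph.deleteEdges_adj]
  refine ⟨hw', ?_⟩
  simp only [Set.mem_singleton_iff, Sym2.eq_iff, not_or, not_and]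
  exact ⟨fun _ h => hne h.symm, fun h _ => hw.ne h⟩

theorem IsProperColoring.anti {V : Type*} {H K : SimpleGraph V} {q : ℕ} {η : V → Fin q}
    (h : IsProperColoring H η) (hle : K ≤ H) : IsProperColoring K η :=
  fun u w huw => h u w (hle huw)

/-- The marginal at `v` of the uniform distribution on the colorings of `H` that agree with `η`
off `W`. -/
noncomputable def vertexMarginal {V : Type*} (H : SimpleGraph V) {q : ℕ} (W : Finset V)
    (η : V → Fin q) (v : V) (c : Fin q) : ℝ :=
  ((coloringsAgreeingOff H W η ∩ {τ | τ v = c}).ncard : ℝ) / (coloringsAgreeingOff H W η).ncard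

theorem vertexMarginal_nonneg {V : Type*} (H : SimpleGraph V) {q : ℕ} (W : Finset V)
    (η : V → Fin q) (v : V) (c : Fin q) : 0 ≤ vertexMarginal H W η v c := by
  unfold vertexMarginal; positivity

theorem sum_vertexMarginal {V : Type*} {H : SimpleGraph V} {q : ℕ} (W : Finset V)
    {η : V → Fin q} (hη : IsProperColoring H η) (v : V) :
    ∑ c, vertexMarginal H W η v c = 1 := by
  simp only [vertexMarginal]
  rw [← Finset.sum_div, ← Nat.cast_sum,
    ← (finite_coloringsAgreeingOff H W η).ncard_eq_sum_inter_eq v]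
  exact div_self (Nat.cast_ne_zero.2 (ncard_coloringsAgreeingOff_pos W hη).ne')

theorem vertexMarginal_of_notMem {V : Type*} {H : SimpleGraph V} {q : ℕ} {W : Finset V}
    {η : V → Fin q} (hη : IsProperColoring H η) {v : V} (hv : v ∉ W) (c : Fin q) :
    vertexMarginal H W η v c = if η v = c then 1 else 0 := by
  have hpos := (ncard_coloringsAgreeingOff_pos W hη).ne'
  unfold vertexMarginal
  split_ifs with h
  · rw [Set.inter_eq_left.2, div_self (Nat.cast_ne_zero.2 hpos)]
    intro τ hτ
    exact (hτ.2 v hv).trans h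
  · have : coloringsAgreeingOff H W η ∩ {τ | τ v = c} = ∅ := by
      ext τ
      simp only [Set.mem_inter_iff, Set.mem_ofPred_eq, Set.mem_empty_iff_false, iff_false, not_and]
      intro hτ hc
      exact h ((hτ.2 v hv).symm.trans hc)
    simp [this]

theorem ncard_inter_ne {V : Type*} {H : SimpleGraph V} {q : ℕ} (W : Finset V)
    {η : V → Fin q} (hη : IsProperColoring H η) (v : V) (c : Fin q) :
    ((coloringsAgreeingOff H W η ∩ {τ | τ v ≠ c}).ncard : ℝ)
      = (coloringsAgreeingOff H W η).ncard * (1 - vertexMarginal H W η v c) := by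
  have hpos : ((coloringsAgreeingOff H W η).ncard : ℝ) ≠ 0 :=
    Nat.cast_ne_zero.2 (ncard_coloringsAgreeingOff_pos W hη).ne'
  have h := Set.ncard_inter_add_ncard_sdiff_eq_ncard (coloringsAgreeingOff H W η) {τ | τ v = c}
    (finite_coloringsAgreeingOff H W η)
  have e : coloringsAgreeingOff H W η \ {τ | τ v = c}
      = coloringsAgreeingOff H W η ∩ {τ | τ v ≠ c} := rfl
  rw [e] at h
  rw [vertexMarginal, mul_sub, mul_div_cancel₀ _ hpos, mul_one, ← h]
  push_cast
  ring

/-- Colors at an isolated free vertex are equidistributed. -/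
theorem ncard_inter_eq_isolate {V : Type*} {H : SimpleGraph V} {q : ℕ} {W : Finset V}
    {η : V → Fin q} {v : V} (hv : v ∈ W) (c c' : Fin q) :
    (coloringsAgreeingOff (isolate H v) W η ∩ {τ | τ v = c}).ncard
      ≤ (coloringsAgreeingOff (isolate H v) W η ∩ {τ | τ v = c'}).ncard := by
  classical
  -- Recoloring `v` violates no constraint, as `v` has no edges left, and is injective where the old
  -- color is fixed.
  refine Set.ncard_le_ncard_of_injOn (fun τ => Function.update τ v c') ?_ ?_
    ((finite_coloringsAgreeingOff _ W η).inter_of_left _)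
  · rintro τ ⟨⟨hp, ho⟩, -⟩
    refine ⟨⟨fun a b hab => ?_, fun u hu => ?_⟩, by simp⟩
    · simpa [hab.2.1, hab.2.2] using hp a b hab
    · have : u ≠ v := fun h => hu (h ▸ hv)
      simpa [this] using ho u hu
  · rintro τ ⟨-, hc⟩ τ' ⟨-, hc'⟩ h
    funext u
    by_cases hu : u = v
    · rw [hu]; exact hc.trans hc'.symm
    · simpa [hu] using congrFun h u

/-- In `isolate H v` the vertex `v` and its former neighbors lie in distinct components, so the
constraints `τ w ≠ c` are independent of each other and of the color of `v`. Neighbors are added one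
at a time, splitting off the component of the new one. -/
theorem ncard_inter_forall_ne {V : Type*} {H : SimpleGraph V} (hH : H.IsAcyclic) {q : ℕ}
    (W : Finset V) {η : V → Fin q} (hη : IsProperColoring H η) (v : V) (c : Fin q)
    (T : Finset V) (hT : ∀ w ∈ T, H.Adj v w) :
    ((coloringsAgreeingOff (isolate H v) W η ∩ {τ | τ v = c ∧ ∀ w ∈ T, τ w ≠ c}).ncard : ℝ)
      = (coloringsAgreeingOff (isolate H v) W η ∩ {τ | τ v = c}).ncard *
        ∏ w ∈ T, (1 - vertexMarginal (isolate H v) W η w c) := by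
  classical
  have hη' := hη.anti (isolate_le H v)
  have hpos : ((coloringsAgreeingOff (isolate H v) W η).ncard : ℝ) ≠ 0 :=
    Nat.cast_ne_zero.2 (ncard_coloringsAgreeingOff_pos W hη').ne'
  induction T using Finset.induction_on with
  | empty => simp
  | insert w T hw ih =>
    have hvw := hT w (Finset.mem_insert_self w T)
    have ih' := ih fun w' hw' => hT w' (Finset.mem_insert_of_mem hw')
    have hind := ncard_inter_mul_ncard (H := isolate H v) (W := W) (η := η)
      (A := {u | (isolate H v).Reachable w u})
      (X := {τ | τ v = c ∧ ∀ w ∈ T, τ w ≠ c}) (Y := {τ | τ w ≠ c})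
      (fun a b hab => ⟨fun h => h.trans hab.reachable, fun h => h.trans hab.symm.reachable⟩)
      (by
        rintro τ τ' h ⟨h1, h2⟩
        refine ⟨(h v (not_reachable_isolate hvw.ne')) ▸ h1, fun w' hw' => ?_⟩
        rw [← h w' (hH.not_reachable_isolate hvw (hT w' (Finset.mem_insert_of_mem hw'))
          fun e => hw (e ▸ hw'))]
        exact h2 w' hw')
      (by
        intro τ τ' h h1
        simpa [h w (SimpleGraph.Reachable.refl w)] using h1)
    have e : {τ : V → Fin q | τ v = c ∧ ∀ w' ∈ insert w T, τ w' ≠ c}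
        = {τ | τ v = c ∧ ∀ w ∈ T, τ w ≠ c} ∩ {τ | τ w ≠ c} := by
      ext τ
      simp only [Finset.forall_mem_insert, Set.mem_ofPred_eq, Set.mem_inter_iff]
      tauto
    have hind' : ((coloringsAgreeingOff (isolate H v) W η ∩
        ({τ | τ v = c ∧ ∀ w ∈ T, τ w ≠ c} ∩ {τ | τ w ≠ c})).ncard : ℝ) *
        (coloringsAgreeingOff (isolate H v) W η).ncard
        = (coloringsAgreeingOff (isolate H v) W η ∩ {τ | τ v = c ∧ ∀ w ∈ T, τ w ≠ c}).ncard *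
          (coloringsAgreeingOff (isolate H v) W η ∩ {τ | τ w ≠ c}).ncard := by
      exact_mod_cast hind
    rw [e, Finset.prod_insert hw]
    rw [ncard_inter_ne W hη', ih'] at hind'
    apply mul_right_cancel₀ hpos
    rw [hind']
    ring

/-- The sum-product recursion for the marginals of the uniform coloring of a forest. -/
theorem vertexMarginal_eq {V : Type*} {H : SimpleGraph V} (hH : H.IsAcyclic) {q : ℕ}
    {W : Finset V} {η : V → Fin q} (hη : IsProperColoring H η) {v : V} (hv : v ∈ W)
    (N : Finset V) (hN : ∀ w, w ∈ N ↔ H.Adj v w) (c : Fin q) :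
    vertexMarginal H W η v c
      = (∏ w ∈ N, (1 - vertexMarginal (isolate H v) W η w c)) /
        ∑ c', ∏ w ∈ N, (1 - vertexMarginal (isolate H v) W η w c') := by
  -- Restoring the edges at `v` amounts to forbidding the color of `v` at its neighbors.
  have hset : ∀ c, coloringsAgreeingOff H W η ∩ {τ | τ v = c}
      = coloringsAgreeingOff (isolate H v) W η ∩ {τ | τ v = c ∧ ∀ w ∈ N, τ w ≠ c} := by
    intro c
    ext τ
    constructor
    · rintro ⟨⟨hp, ho⟩, hc⟩
      refine ⟨⟨hp.anti (isolate_le H v), ho⟩, hc, fun w hw => ?_⟩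
      have hc' : τ v = c := hc
      exact hc' ▸ (hp v w ((hN w).1 hw)).symm
    · rintro ⟨⟨hp, ho⟩, hc, hne⟩
      refine ⟨⟨fun a b hab => ?_, ho⟩, hc⟩
      by_cases ha : a = v
      · subst ha
        rw [hc]; exact (hne b ((hN b).2 hab)).symm
      · by_cases hb : b = v
        · subst hb
          rw [hc]; exact hne a ((hN a).2 hab.symm)
        · exact hp a b ⟨hab, ha, hb⟩
  have hη' := hη.anti (isolate_le H v)
  -- `K` does not depend on the color, so it cancels on normalizing.
  set K : ℝ := ((coloringsAgreeingOff (isolate H v) W η ∩ {τ | τ v = c}).ncard : ℝ) with hK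
  have hKc : ∀ c', ((coloringsAgreeingOff (isolate H v) W η ∩ {τ | τ v = c'}).ncard : ℝ) = K :=
    fun c' => by
      rw [hK]
      exact_mod_cast le_antisymm (ncard_inter_eq_isolate hv c' c) (ncard_inter_eq_isolate hv c c')
  have hKne : K ≠ 0 := by
    intro h0
    have h1 := (finite_coloringsAgreeingOff (isolate H v) W η).ncard_eq_sum_inter_eq v
    have h2 : ((coloringsAgreeingOff (isolate H v) W η).ncard : ℝ) = 0 := by
      rw [h1]
      push_cast
      exact Finset.sum_eq_zero fun c' _ => (hKc c').trans h0
    exact (ncard_coloringsAgreeingOff_pos W hη').ne' (by exact_mod_cast h2)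
  have hcount : ∀ c', ((coloringsAgreeingOff H W η ∩ {τ | τ v = c'}).ncard : ℝ)
      = K * ∏ w ∈ N, (1 - vertexMarginal (isolate H v) W η w c') := fun c' => by
    rw [hset, ncard_inter_forall_ne hH W hη v c' N (fun w hw => (hN w).1 hw), hKc]
  rw [vertexMarginal, (finite_coloringsAgreeingOff H W η).ncard_eq_sum_inter_eq v, hcount]
  push_cast
  simp only [hcount]
  rw [← Finset.mul_sum, mul_div_mul_left _ _ hKne]

/-- Marginals at a free vertex of degree at most `b` are bounded by `1 / (q - b)`. -/
theorem vertexMarginal_le {V : Type*} {H : SimpleGraph V} (hH : H.IsAcyclic) {q : ℕ}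
    {W : Finset V} {η : V → Fin q} (hη : IsProperColoring H η) {v : V} (hv : v ∈ W)
    (N : Finset V) (hN : ∀ w, w ∈ N ↔ H.Adj v w) (b : ℕ) (hNb : N.card ≤ b) (hbq : b < q)
    (c : Fin q) :
    vertexMarginal H W η v c ≤ 1 / ((q : ℝ) - b) := by
  classical
  have hη' := hη.anti (isolate_le H v)
  set x := fun w => vertexMarginal (isolate H v) W η w with hx
  have h0 : ∀ w c, 0 ≤ x w c := fun w c => vertexMarginal_nonneg _ _ _ _ _
  have h1 : ∀ w, ∑ c, x w c = 1 := fun w => sum_vertexMarginal W hη' w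
  have hle : ∀ w c, x w c ≤ 1 := fun w c =>
    h1 w ▸ Finset.single_le_sum (fun c' _ => h0 w c') (Finset.mem_univ c)
  have hNb' : (N.card : ℝ) ≤ b := by exact_mod_cast hNb
  have hbq' : (b : ℝ) + 1 ≤ q := by exact_mod_cast hbq
  rw [vertexMarginal_eq hH hη hv N hN]
  change (∏ w ∈ N, (1 - x w c)) / ∑ c', ∏ w ∈ N, (1 - x w c') ≤ _
  set P : Fin q → ℝ := fun c => ∏ w ∈ N, (1 - x w c) with hP
  have hP0 : 0 ≤ P c := Finset.prod_nonneg fun w _ => sub_nonneg.2 (hle w c)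
  have hP1 : P c ≤ 1 := Finset.prod_le_one (fun w _ => sub_nonneg.2 (hle w c))
    fun w _ => by linarith [h0 w c]
  -- The other colors have total weight at least `q - 1 - b`. Together with `P c ≤ 1` this gives `P
  -- c * (q - b) ≤ ∑ c', P c'`.
  have hrest : (q : ℝ) - 1 - b ≤ ∑ c' ∈ Finset.univ.erase c, P c' := by
    calc (q : ℝ) - 1 - b ≤ ∑ c' ∈ Finset.univ.erase c, (1 - ∑ w ∈ N, x w c') := by
          rw [Finset.sum_sub_distrib, Finset.sum_comm]
          have e1 : ∑ c' ∈ Finset.univ.erase c, (1 : ℝ) = q - 1 := by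
            rw [Finset.sum_const, Finset.card_erase_of_mem (Finset.mem_univ c)]
            simp only [Finset.card_univ, Fintype.card_fin, nsmul_eq_mul, mul_one]
            rw [Nat.cast_sub (by omega)]
            simp
          have e2 : ∑ w ∈ N, ∑ c' ∈ Finset.univ.erase c, x w c' ≤ N.card := by
            calc _ ≤ ∑ w ∈ N, (1 : ℝ) := Finset.sum_le_sum fun w _ => by
                  rw [← h1 w]
                  exact Finset.sum_le_sum_of_subset_of_nonneg (Finset.erase_subset _ _)
                    fun c' _ _ => h0 w c'
              _ = _ := by simp
          linarith
      _ ≤ _ := Finset.sum_le_sum fun c' _ =>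
          one_sub_sum_le_prod_one_sub N _ (fun w _ => h0 w c') (fun w _ => hle w c')
  have hZ : ∑ c', P c' = P c + ∑ c' ∈ Finset.univ.erase c, P c' :=
    (Finset.add_sum_erase _ _ (Finset.mem_univ c)).symm
  have hn : (0 : ℝ) < (q : ℝ) - b := by linarith
  have hZ' := card_sub_le_sum_prod N x (fun w _ c => h0 w c) (fun w _ => h1 w)
  rw [Fintype.card_fin] at hZ'
  change P c / ∑ c', P c' ≤ _
  have hZpos : 0 < ∑ c', P c' := by
    have : ∑ c', P c' = ∑ c', ∏ w ∈ N, (1 - x w c') := rfl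
    linarith
  rw [div_le_div_iff₀ hZpos hn, one_mul, hZ]
  nlinarith

/-! ### Decay of correlations in finite volume -/

/-- Two boundary conditions coincide within walk distance `d` of `v`. -/
def AgreesWithin {V : Type*} (H : SimpleGraph V) {q : ℕ} (W W' : Finset V) (η η' : V → Fin q)
    (v : V) (d : ℕ) : Prop :=
  ∀ u, ∀ p : H.Walk v u, p.length ≤ d → (u ∈ W ↔ u ∈ W') ∧ (u ∉ W → η u = η' u)

/-- A walk from `w` is prolonged by the edge `v w`. Walks are used rather than `dist`, because
`isolate` disconnects vertices and `dist` is `0` across components. -/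
theorem AgreesWithin.isolate {V : Type*} {H : SimpleGraph V} {q : ℕ} {W W' : Finset V}
    {η η' : V → Fin q} {v : V} {d : ℕ} (h : AgreesWithin H W W' η η' v (d + 1)) {w : V}
    (hw : H.Adj v w) : AgreesWithin (isolate H v) W W' η η' w d := by
  intro u p hp
  refine h u (SimpleGraph.Walk.cons hw (p.mapLe (isolate_le H v))) ?_
  simpa using hp

theorem hellinger_le_two {κ : Type*} [Fintype κ] (x x' : κ → ℝ) (h0 : ∀ c, 0 ≤ x c)
    (h0' : ∀ c, 0 ≤ x' c) (h1 : ∑ c, x c = 1) (h1' : ∑ c, x' c = 1) :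
    ∑ c, (√(x c) - √(x' c)) ^ 2 ≤ 2 := by
  calc ∑ c, (√(x c) - √(x' c)) ^ 2 ≤ ∑ c, (x c + x' c) := by
        refine Finset.sum_le_sum fun c _ => ?_
        rw [sub_sq, Real.sq_sqrt (h0 c), Real.sq_sqrt (h0' c)]
        have := mul_nonneg (Real.sqrt_nonneg (x c)) (Real.sqrt_nonneg (x' c))
        linarith
    _ = 2 := by rw [Finset.sum_add_distrib, h1, h1']; norm_num

theorem encard_neighborSet_isolate_le {V : Type*} (H : SimpleGraph V) (v u : V) :
    ((isolate H v).neighborSet u).encard ≤ (H.neighborSet u).encard :=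
  Set.encard_le_encard fun _ h => h.1

/-- The edge to the parent is lost: degree `b + 1` becomes branching number `b`. -/
theorem encard_neighborSet_isolate_le_of_adj {V : Type*} {H : SimpleGraph V} {v w : V}
    (hw : H.Adj v w) {b : ℕ} (hb : (H.neighborSet w).encard ≤ b + 1) :
    ((isolate H v).neighborSet w).encard ≤ b := by
  have hsub : (isolate H v).neighborSet w ⊆ H.neighborSet w \ {v} :=
    fun u hu => ⟨hu.1, hu.2.2⟩
  have h := Set.encard_sdiff_singleton_add_one (s := H.neighborSet w) (a := v) hw.symm
  refine (Set.encard_le_encard hsub).trans ?_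
  rw [← h] at hb
  exact (ENat.add_le_add_iff_right (by simp)).1 hb

theorem exists_finset_of_encard_neighborSet_le {V : Type*} {H : SimpleGraph V} {v : V} {b : ℕ}
    (hb : (H.neighborSet v).encard ≤ b) :
    ∃ N : Finset V, (∀ w, w ∈ N ↔ H.Adj v w) ∧ N.card ≤ b := by
  have hfin : (H.neighborSet v).Finite := Set.finite_of_encard_le_coe hb
  refine ⟨hfin.toFinset, fun w => by simp, ?_⟩
  rw [hfin.encard_eq_coe_toFinset_card] at hb
  exact_mod_cast hb

/-- One step of the recursion for the distance between marginals under two boundary conditions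
that agree near the root. -/
theorem hellinger_vertexMarginal_step {V : Type*} {b q k : ℕ} (hbq : b + 2 ≤ q)
    (hkq : k < q) {H : SimpleGraph V} (hH : H.IsAcyclic)
    (hdeg : ∀ u, (H.neighborSet u).encard ≤ b + 1) {v : V} (hk : (H.neighborSet v).encard ≤ k)
    {W W' : Finset V} {η η' : V → Fin q} (hη : IsProperColoring H η)
    (hη' : IsProperColoring H η') (hv : v ∈ W) {d : ℕ}
    (hag : AgreesWithin H W W' η η' v (d + 1)) {ε : ℝ} (hε : 0 ≤ ε)
    (ih : ∀ w, H.Adj v w → w ∈ W → ∑ c, (√(vertexMarginal (isolate H v) W η w c)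
      - √(vertexMarginal (isolate H v) W' η' w c)) ^ 2 ≤ ε) :
    ∑ c, (√(vertexMarginal H W η v c) - √(vertexMarginal H W' η' v c)) ^ 2
      ≤ 1 / ((q : ℝ) - k) *
        ((1 / (1 - 1 / ((q : ℝ) - b))) ^ 2 * Real.exp (-1)) * (k * ε) := by
  obtain ⟨N, hN, hNk⟩ := exists_finset_of_encard_neighborSet_le hk
  have hv' : v ∈ W' := ((hag v SimpleGraph.Walk.nil (by simp)).1).1 hv
  have hbq' : (b : ℝ) + 2 ≤ q := by exact_mod_cast hbq
  have hkq' : (k : ℝ) + 1 ≤ q := by exact_mod_cast hkq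
  have hNk' : (N.card : ℝ) ≤ k := by exact_mod_cast hNk
  have hiη := hη.anti (isolate_le H v)
  have hiη' := hη'.anti (isolate_le H v)
  have hiH : (isolate H v).IsAcyclic := hH.anti (isolate_le H v)
  simp only [vertexMarginal_eq hH hη hv N hN, vertexMarginal_eq hH hη' hv' N hN]
  have hchild : ∀ w ∈ N, (w ∈ W ↔ w ∈ W') ∧ (w ∉ W → η w = η' w) := fun w hw =>
    hag w (SimpleGraph.Walk.cons ((hN w).1 hw) SimpleGraph.Walk.nil) (by simp)
  have hpin : ∀ w ∈ N, w ∉ W → vertexMarginal (isolate H v) W η w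
      = vertexMarginal (isolate H v) W' η' w := fun w hw hwW => by
    funext c
    rw [vertexMarginal_of_notMem hiη hwW,
      vertexMarginal_of_notMem hiη' (fun h => hwW ((hchild w hw).1.2 h)), (hchild w hw).2 hwW]
  have hr : 1 / ((q : ℝ) - b) < 1 := by
    rw [div_lt_one (by linarith)]; linarith
  refine (hellinger_sum_product_le N (fun w => vertexMarginal (isolate H v) W η w)
    (fun w => vertexMarginal (isolate H v) W' η' w) (1 / ((q : ℝ) - b)) ((q : ℝ) - k) hr
    (by linarith) (by rw [Fintype.card_fin]; linarith)
    (fun _ _ _ => vertexMarginal_nonneg _ _ _ _ _) (fun _ _ _ => vertexMarginal_nonneg _ _ _ _ _)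
    (fun _ _ => sum_vertexMarginal W hiη _) (fun _ _ => sum_vertexMarginal W' hiη' _)
    fun w hw => ?_).trans ?_
  -- A free child has at most `b` neighbors left, hence marginals at most `1 / (q - b)`; a pinned
  -- child has the same point mass under both boundary conditions.
  · by_cases hwW : w ∈ W
    · right
      intro c
      obtain ⟨M, hM, hMb⟩ := exists_finset_of_encard_neighborSet_le
        (encard_neighborSet_isolate_le_of_adj ((hN w).1 hw) (hdeg w))
      exact ⟨vertexMarginal_le hiH hiη hwW M hM b hMb (by omega) c,
        vertexMarginal_le hiH hiη' ((hchild w hw).1.1 hwW) M hM b hMb (by omega) c⟩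
    · left
      exact hpin w hw hwW
  · have hq0 : (0 : ℝ) < (q : ℝ) - k := by linarith
    gcongr
    calc _ ≤ ∑ w ∈ N, ε := Finset.sum_le_sum fun w hw => by
          by_cases hwW : w ∈ W
          · exact ih w ((hN w).1 hw) hwW
          · simp [hpin w hw hwW, hε]
      _ = N.card * ε := by simp
      _ ≤ k * ε := by gcongr

/-- Exponential decay of correlations at a vertex of a forest with at most `b` neighbors. -/
theorem hellinger_vertexMarginal_le {V : Type*} {b q : ℕ} (hb : 1 ≤ b)
    (hq : 7 * b + 4 ≤ 4 * q) (d : ℕ) :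
    ∀ (H : SimpleGraph V), H.IsAcyclic → (∀ u, (H.neighborSet u).encard ≤ b + 1) →
    ∀ v, (H.neighborSet v).encard ≤ b → ∀ (W W' : Finset V) (η η' : V → Fin q),
    IsProperColoring H η → IsProperColoring H η' → v ∈ W → AgreesWithin H W W' η η' v d →
    ∑ c, (√(vertexMarginal H W η v c) - √(vertexMarginal H W' η' v c)) ^ 2
      ≤ 2 * (99 / 100) ^ d := by
  induction d with
  | zero =>
    intro H _ _ v _ W W' η η' hη hη' _ _
    simpa using hellinger_le_two _ _ (fun _ => vertexMarginal_nonneg _ _ _ _ _)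
      (fun _ => vertexMarginal_nonneg _ _ _ _ _) (sum_vertexMarginal W hη v)
      (sum_vertexMarginal W' hη' v)
  | succ d ih =>
    intro H hH hdeg v hv W W' η η' hη hη' hvW hag
    refine (hellinger_vertexMarginal_step (by omega) (by omega) hH hdeg hv hη hη' hvW hag
      (ε := 2 * (99 / 100) ^ d) (by positivity) fun w hw hwW => ?_).trans ?_
    · exact ih _ (hH.anti (isolate_le H v))
        (fun u => (encard_neighborSet_isolate_le H v u).trans (hdeg u)) w
        (encard_neighborSet_isolate_le_of_adj hw (hdeg w)) W W' η η'
        (hη.anti (isolate_le H v)) (hη'.anti (isolate_le H v)) hwW (hag.isolate hw)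
    · have h := contraction_factor_le b q hb hq
      have h2 : (0 : ℝ) ≤ 2 * (99 / 100) ^ d := by positivity
      calc _ = (b : ℝ) * (1 / ((q : ℝ) - b) *
            ((1 / (1 - 1 / ((q : ℝ) - b))) ^ 2 * Real.exp (-1))) * (2 * (99 / 100) ^ d) := by ring
        _ ≤ 99 / 100 * (2 * (99 / 100) ^ d) := by gcongr
        _ = _ := by ring

/-- Pointwise differences of probabilities are controlled by the Hellinger distance. -/
theorem abs_sub_le_two_mul_sqrt {x y s : ℝ} (hx : 0 ≤ x) (hy : 0 ≤ y) (hx1 : x ≤ 1) (hy1 : y ≤ 1)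
    (h : (√x - √y) ^ 2 ≤ s) : |x - y| ≤ 2 * √s := by
  have e : x - y = (√x - √y) * (√x + √y) := by
    linear_combination Real.sq_sqrt hy - Real.sq_sqrt hx
  rw [e, abs_mul, mul_comm]
  have h1 : |√x - √y| ≤ √s := Real.abs_le_sqrt h
  have h2 : |√x + √y| ≤ 2 := by
    rw [abs_of_nonneg (by positivity)]
    have := Real.sqrt_le_one.2 hx1
    have := Real.sqrt_le_one.2 hy1
    linarith
  gcongr

/-- Exponential decay of correlations at any vertex of a forest of maximum degree `b + 1`. -/
theorem exists_abs_vertexMarginal_sub_le {b q : ℕ} (hb : 1 ≤ b) (hq : 7 * b + 4 ≤ 4 * q) :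
    ∃ C : ℝ, 0 < C ∧ ∀ (V : Type*) (G : SimpleGraph V), G.IsAcyclic →
    (∀ u, (G.neighborSet u).encard ≤ b + 1) →
    ∀ (v : V) (W W' : Finset V) (η η' : V → Fin q) (d : ℕ),
    IsProperColoring G η → IsProperColoring G η' → v ∈ W → AgreesWithin G W W' η η' v d →
    ∀ c, |vertexMarginal G W η v c - vertexMarginal G W' η' v c| ≤ C * √(99 / 100) ^ d := by
  -- The factor of the single step at the root, with `b + 1` children. It is applied once, so it
  -- need not be below `1`.
  set K : ℝ := 1 / ((q : ℝ) - ((b + 1 : ℕ) : ℝ)) *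
    ((1 / (1 - 1 / ((q : ℝ) - b))) ^ 2 * Real.exp (-1)) * ((b + 1 : ℕ) : ℝ) with hK
  have hK0 : 0 ≤ K := by
    have : ((b + 1 : ℕ) : ℝ) + 1 ≤ q := by
      have : b + 1 + 1 ≤ q := by omega
      exact_mod_cast this
    have : 0 < (q : ℝ) - ((b + 1 : ℕ) : ℝ) := by linarith
    positivity
  -- The `2` covers `d = 0`. The `4 * K` covers `2 * K` together with the power of `99/100` not
  -- gained at the root.
  refine ⟨2 * √(2 + 4 * K), by positivity, fun V G hG hdeg v W W' η η' d hη hη' hv hag c => ?_⟩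
  have hle : ∀ (W : Finset V) (η : V → Fin q), IsProperColoring G η →
      vertexMarginal G W η v c ≤ 1 := fun W η hη => by
    rw [← sum_vertexMarginal W hη v]
    exact Finset.single_le_sum (fun c' _ => vertexMarginal_nonneg G W η v c') (Finset.mem_univ c)
  have hsum : ∑ c, (√(vertexMarginal G W η v c) - √(vertexMarginal G W' η' v c)) ^ 2
      ≤ (2 + 4 * K) * (99 / 100) ^ d := by
    cases d with
    | zero =>
      have := hellinger_le_two _ _ (fun _ => vertexMarginal_nonneg _ _ _ _ _)
        (fun _ => vertexMarginal_nonneg _ _ _ _ _) (sum_vertexMarginal W hη v)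
        (sum_vertexMarginal W' hη' v)
      simp only [pow_zero, mul_one]
      linarith
    | succ d =>
      refine (hellinger_vertexMarginal_step (k := b + 1) (by omega) (by omega) hG hdeg
        (by exact_mod_cast hdeg v) hη hη' hv hag (ε := 2 * (99 / 100) ^ d) (by positivity)
        fun w hw hwW => ?_).trans ?_
      · exact hellinger_vertexMarginal_le hb hq d _ (hG.anti (isolate_le G v))
          (fun u => (encard_neighborSet_isolate_le G v u).trans (hdeg u)) w
          (encard_neighborSet_isolate_le_of_adj hw (hdeg w)) W W' η η'
          (hη.anti (isolate_le G v)) (hη'.anti (isolate_le G v)) hwW (hag.isolate hw)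
      · have hp : (0 : ℝ) ≤ (99 / 100) ^ d := by positivity
        have h2 : 0 ≤ K * (99 / 100) ^ d := mul_nonneg hK0 hp
        calc _ = 2 * K * (99 / 100) ^ d := by rw [hK]; ring
          _ ≤ (2 + 4 * K) * (99 / 100) ^ (d + 1) := by rw [pow_succ]; nlinarith
  have hterm := (Finset.single_le_sum (f := fun c => (√(vertexMarginal G W η v c)
    - √(vertexMarginal G W' η' v c)) ^ 2) (fun _ _ => sq_nonneg _) (Finset.mem_univ c)).trans hsum
  refine (abs_sub_le_two_mul_sqrt (vertexMarginal_nonneg _ _ _ _ _)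
    (vertexMarginal_nonneg _ _ _ _ _) (hle W η hη) (hle W' η' hη') hterm).trans_eq ?_
  have hpow : √(((99 : ℝ) / 100) ^ d) = √(99 / 100) ^ d := by
    rw [Real.sqrt_eq_iff_mul_self_eq (by positivity) (by positivity), ← mul_pow,
      Real.mul_self_sqrt (by norm_num)]
  rw [Real.sqrt_mul (by positivity), hpow, mul_assoc]

/-! ### Interpolating colorings and cylinder events -/

/-- Greedy recoloring of a finite set of vertices. -/
theorem exists_isProperColoring_of_off {V : Type*} {G : SimpleGraph V} {k q : ℕ} (hkq : k < q)
    (hdeg : ∀ u, (G.neighborSet u).encard ≤ k) (T : Finset V) :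
    ∀ τ : V → Fin q, (∀ u w, G.Adj u w → u ∉ T → w ∉ T → τ u ≠ τ w) →
      ∃ η, IsProperColoring G η ∧ ∀ u ∉ T, η u = τ u := by
  classical
  induction T using Finset.induction_on with
  | empty => exact fun τ h => ⟨τ, fun u w huw => h u w huw (by simp) (by simp), fun _ _ => rfl⟩
  | insert a T ha ih =>
    intro τ h
    obtain ⟨N, hN, hNk⟩ := exists_finset_of_encard_neighborSet_le (hdeg a)
    -- At most `k < q` colors occur around `a`, so one is available.
    obtain ⟨c, hc⟩ : ∃ c, c ∉ N.image τ := by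
      by_contra! hall
      have h1 : (N.image τ).card = q := by
        rw [Finset.eq_univ_of_forall hall]; simp
      have h2 := Finset.card_image_le (s := N) (f := τ)
      omega
    have hcN : ∀ w, G.Adj a w → τ w ≠ c := fun w hw e =>
      hc (Finset.mem_image.2 ⟨w, (hN w).2 hw, e⟩)
    obtain ⟨η, hη, hoff⟩ := ih (Function.update τ a c) (by
      intro u w huw hu hw
      by_cases hua : u = a
      · subst hua
        simpa [huw.ne'] using (hcN w huw).symm
      · by_cases hwa : w = a
        · subst hwa
          simpa [huw.ne] using hcN u huw.symm
        · simpa [hua, hwa] using h u w huw (by simp [hua, hu]) (by simp [hwa, hw]))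
    refine ⟨η, hη, fun u hu => ?_⟩
    rw [Finset.mem_insert, not_or] at hu
    rw [hoff u hu.2, Function.update_of_ne hu.1]

/-- A coloring can be prescribed on a finite set without changing another coloring far away. -/
theorem exists_isProperColoring_interpolating {V : Type*} [DecidableEq V] {G : SimpleGraph V}
    {k q : ℕ} (hkq : k < q) (hdeg : ∀ u, (G.neighborSet u).encard ≤ k) {F R : Finset V}
    (hFR : F ⊆ R) (hR : ∀ u ∈ F, ∀ w, G.Adj u w → w ∈ R) {σ τ : V → Fin q}
    (hσ : IsProperColoring G σ) (hτ : IsProperColoring G τ) :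
    ∃ η, IsProperColoring G η ∧ (∀ u ∈ F, η u = σ u) ∧ ∀ u ∉ R, η u = τ u := by
  -- No edge joins `F` to the complement of `R`, so the only conflicts lie in the buffer `R \ F`,
  -- which is recolored.
  obtain ⟨η, hη, hoff⟩ := exists_isProperColoring_of_off hkq hdeg (R \ F)
    (fun u => if u ∈ F then σ u else τ u) (by
      intro u w huw hu hw
      simp only [Finset.mem_sdiff, not_and, not_not] at hu hw
      by_cases huF : u ∈ F
      · have hwF := hw (hR u huF w huw)
        simpa [huF, hwF] using hσ u w huw
      · by_cases hwF : w ∈ F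
        · exact absurd (hu (hR w hwF u huw.symm)) huF
        · simpa [huF, hwF] using hτ u w huw)
  refine ⟨η, hη, fun u hu => ?_, fun u hu => ?_⟩
  · rw [hoff u (by simp [hu]), if_pos hu]
  · rw [hoff u (by simp [hu]), if_neg fun h => hu (hFR h)]

/-- The event that the colors on `F` are those of `σ`. -/
def agreeOn {V : Type*} {q : ℕ} (F : Finset V) (σ : V → Fin q) : Set (V → Fin q) :=
  {τ | ∀ u ∈ F, τ u = σ u}

theorem measurableSet_agreeOn {V : Type*} {q : ℕ} (F : Finset V) (σ : V → Fin q) :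
    MeasurableSet (agreeOn F σ) := by
  have : agreeOn F σ = ⋂ u ∈ F, (fun τ : V → Fin q => τ u) ⁻¹' {σ u} := by
    ext τ; simp [agreeOn]
  rw [this]
  exact Finset.measurableSet_biInter F fun u _ => measurable_pi_apply u (measurableSet_singleton _)

theorem measurableSet_eval_eq {V : Type*} {q : ℕ} (v : V) (c : Fin q) :
    MeasurableSet {τ : V → Fin q | τ v = c} := by
  have : {τ : V → Fin q | τ v = c} = (fun τ : V → Fin q => τ v) ⁻¹' {c} := by
    ext τ; simp
  rw [this]
  exact measurable_pi_apply v (measurableSet_singleton c)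

theorem coloringsAgreeingOff_inter_agreeOn {V : Type*} [DecidableEq V] {G : SimpleGraph V}
    {q : ℕ} {F R : Finset V} {σ τ η : V → Fin q} (hF : ∀ u ∈ F, η u = σ u)
    (hR : ∀ u ∉ R, η u = τ u) :
    coloringsAgreeingOff G R τ ∩ agreeOn F σ = coloringsAgreeingOff G (R \ F) η := by
  ext ρ
  constructor
  · rintro ⟨⟨hp, ho⟩, ha⟩
    refine ⟨hp, fun u hu => ?_⟩
    by_cases huF : u ∈ F
    · rw [ha u huF, hF u huF]
    · have huR : u ∉ R := fun h => hu (Finset.mem_sdiff.2 ⟨h, huF⟩)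
      rw [ho u huR, hR u huR]
  · rintro ⟨hp, ho⟩
    refine ⟨⟨hp, fun u hu => ?_⟩, fun u hu => ?_⟩
    · rw [ho u (by simp [hu]), hR u hu]
    · rw [ho u (by simp [hu]), hF u hu]

/-- Conditioning the uniform coloring of `R` on the colors of `F` gives the uniform coloring of `R \
F` with boundary condition `η`. -/
theorem uniformInRegion_inter_agreeOn {V : Type*} [DecidableEq V] {G : SimpleGraph V}
    {q : ℕ} {F R : Finset V} {σ τ η : V → Fin q} (hη : IsProperColoring G η)
    (hF : ∀ u ∈ F, η u = σ u) (hR : ∀ u ∉ R, η u = τ u) (v : V) (c : Fin q) :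
    uniformInRegion G R τ (agreeOn F σ ∩ {ρ | ρ v = c})
      = ENNReal.ofReal (vertexMarginal G (R \ F) η v c) *
        uniformInRegion G R τ (agreeOn F σ) := by
  have hpos := ncard_coloringsAgreeingOff_pos (R \ F) hη
  simp only [uniformInRegion, ← Set.inter_assoc, coloringsAgreeingOff_inter_agreeOn hF hR,
    vertexMarginal]
  rw [ENNReal.ofReal_div_of_pos (by exact_mod_cast hpos), ENNReal.ofReal_natCast,
    ENNReal.ofReal_natCast, ← mul_div_assoc, ENNReal.div_mul_cancel (by exact_mod_cast hpos.ne')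
      (ENNReal.natCast_ne_top _)]

theorem ncard_coloringsAgreeingOff_le {V : Type*} (G : SimpleGraph V) {q : ℕ} (R : Finset V)
    (τ : V → Fin q) : (coloringsAgreeingOff G R τ).ncard ≤ Nat.card (R → Fin q) := by
  classical
  rw [← Set.ncard_univ]
  refine Set.ncard_le_ncard_of_injOn (fun ρ (u : R) => ρ u) (fun _ _ => Set.mem_univ _) ?_
    Set.finite_univ
  intro ρ hρ ρ' hρ' h
  funext u
  by_cases hu : u ∈ R
  · exact congrFun h ⟨u, hu⟩
  · rw [hρ.2 u hu, hρ'.2 u hu]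

/-! ### From finite-volume marginals to Gibbs measures -/

section Gibbs

variable {V : Type*} {G : SimpleGraph V} {k q : ℕ} {p : Measure (V → Fin q)}

theorem IsGibbsMeasure.measure_eq_lintegral (hp : IsGibbsMeasure G p) (R : Finset V)
    {A : Set (V → Fin q)} (hA : MeasurableSet A) :
    p A = ∫⁻ τ, uniformInRegion G R τ A ∂p := by
  have := hp.conditional R A Set.univ hA MeasurableSet.univ
  simpa using this

variable [DecidableEq V]

/-- Every cylinder that contains a coloring is charged by a Gibbs measure. -/
theorem IsGibbsMeasure.measure_agreeOn_ne_zero (hp : IsGibbsMeasure G p) (hkq : k < q)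
    (hdeg : ∀ u, (G.neighborSet u).encard ≤ k) (F : Finset V) {σ : V → Fin q}
    (hσ : IsProperColoring G σ) : p (agreeOn F σ) ≠ 0 := by
  have := hp.isProbabilityMeasure
  choose N hN _ using fun u => exists_finset_of_encard_neighborSet_le (hdeg u)
  set R : Finset V := F ∪ F.biUnion N with hRdef
  have hFR : F ⊆ R := Finset.subset_union_left
  have hR : ∀ u ∈ F, ∀ w, G.Adj u w → w ∈ R := fun u hu w hw =>
    Finset.mem_union_right _ (Finset.mem_biUnion.2 ⟨u, hu, (hN u w).2 hw⟩)
  -- Whatever the colors outside `R`, at least one of the at most `|R → Fin q|` compatible colorings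
  -- lies in the cylinder.
  have hlow : ∀ᵐ τ ∂p, ((Nat.card (R → Fin q) : ℝ≥0∞))⁻¹
      ≤ uniformInRegion G R τ (agreeOn F σ) := by
    filter_upwards [hp.ae_proper] with τ hτ
    obtain ⟨η, hη, hηF, hηR⟩ := exists_isProperColoring_interpolating hkq hdeg hFR hR hσ hτ
    rw [uniformInRegion, coloringsAgreeingOff_inter_agreeOn hηF hηR, ← one_div]
    refine ENNReal.div_le_div ?_ ?_
    · exact_mod_cast ncard_coloringsAgreeingOff_pos (R \ F) hη
    · exact_mod_cast ncard_coloringsAgreeingOff_le G R τ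
  have h := lintegral_mono_ae hlow
  rw [lintegral_const, measure_univ, mul_one,
    ← hp.measure_eq_lintegral R (measurableSet_agreeOn F σ)] at h
  exact (lt_of_lt_of_le (ENNReal.inv_pos.2 (ENNReal.natCast_ne_top _)) h).ne'

/-- Given the colors outside `R` and the cylinder on `F`, the law at `v` is a finite-volume marginal
with free region `R \ F`. Averaging over the outside preserves a uniform bound. -/
theorem IsGibbsMeasure.cond_le (hp : IsGibbsMeasure G p) (hkq : k < q)
    (hdeg : ∀ u, (G.neighborSet u).encard ≤ k) {F R : Finset V} (hFR : F ⊆ R)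
    (hR : ∀ u ∈ F, ∀ w, G.Adj u w → w ∈ R) {σ : V → Fin q} (hσ : IsProperColoring G σ)
    (v : V) (c : Fin q) {M : ℝ} (hM0 : 0 ≤ M)
    (hM : ∀ η, IsProperColoring G η → (∀ u ∈ F, η u = σ u) →
      vertexMarginal G (R \ F) η v c ≤ M) :
    (p[|agreeOn F σ]).real {τ | τ v = c} ≤ M := by
  have := hp.isProbabilityMeasure
  have hE := measurableSet_agreeOn F σ
  have h1 : p (agreeOn F σ ∩ {τ | τ v = c}) ≤ ENNReal.ofReal M * p (agreeOn F σ) := by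
    rw [hp.measure_eq_lintegral R (hE.inter (measurableSet_eval_eq v c)),
      hp.measure_eq_lintegral R hE, ← lintegral_const_mul' _ _ ENNReal.ofReal_ne_top]
    refine lintegral_mono_ae ?_
    filter_upwards [hp.ae_proper] with τ hτ
    obtain ⟨η, hη, hηF, hηR⟩ := exists_isProperColoring_interpolating hkq hdeg hFR hR hσ hτ
    rw [uniformInRegion_inter_agreeOn hη hηF hηR]
    gcongr
    exact hM η hη hηF
  refine ENNReal.toReal_le_of_le_ofReal hM0 ?_
  rw [cond_apply hE, mul_comm, ← div_eq_mul_inv]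
  exact ENNReal.div_le_of_le_mul h1

/-- The lower bound also needs the cylinder to have positive mass, since conditioning on a null
event gives the zero measure. -/
theorem IsGibbsMeasure.le_cond (hp : IsGibbsMeasure G p) (hkq : k < q)
    (hdeg : ∀ u, (G.neighborSet u).encard ≤ k) {F R : Finset V} (hFR : F ⊆ R)
    (hR : ∀ u ∈ F, ∀ w, G.Adj u w → w ∈ R) {σ : V → Fin q} (hσ : IsProperColoring G σ)
    (v : V) (c : Fin q) {M : ℝ}
    (hM : ∀ η, IsProperColoring G η → (∀ u ∈ F, η u = σ u) →
      M ≤ vertexMarginal G (R \ F) η v c) :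
    M ≤ (p[|agreeOn F σ]).real {τ | τ v = c} := by
  have := hp.isProbabilityMeasure
  have hE := measurableSet_agreeOn F σ
  have h1 : ENNReal.ofReal M * p (agreeOn F σ) ≤ p (agreeOn F σ ∩ {τ | τ v = c}) := by
    rw [hp.measure_eq_lintegral R (hE.inter (measurableSet_eval_eq v c)),
      hp.measure_eq_lintegral R hE, ← lintegral_const_mul' _ _ ENNReal.ofReal_ne_top]
    refine lintegral_mono_ae ?_
    filter_upwards [hp.ae_proper] with τ hτ
    obtain ⟨η, hη, hηF, hηR⟩ := exists_isProperColoring_interpolating hkq hdeg hFR hR hσ hτ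
    rw [uniformInRegion_inter_agreeOn hη hηF hηR]
    gcongr
    exact hM η hη hηF
  rw [Measure.real, ← ENNReal.ofReal_le_iff_le_toReal (measure_ne_top _ _), cond_apply hE,
    mul_comm, ← div_eq_mul_inv]
  exact (ENNReal.le_div_iff_mul_le (Or.inl (hp.measure_agreeOn_ne_zero hkq hdeg F hσ))
    (Or.inl (measure_ne_top _ _))).2 h1

/-- A uniform comparison of finite-volume marginals passes to the conditional probabilities
under a Gibbs measure. -/
theorem IsGibbsMeasure.cond_le_cond_add (hp : IsGibbsMeasure G p) (hkq : k < q)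
    (hdeg : ∀ u, (G.neighborSet u).encard ≤ k) {F F' R : Finset V} (hFR : F ⊆ R)
    (hFR' : F' ⊆ R) (hR : ∀ u ∈ F, ∀ w, G.Adj u w → w ∈ R)
    (hR' : ∀ u ∈ F', ∀ w, G.Adj u w → w ∈ R) {σ φ : V → Fin q} (hσ : IsProperColoring G σ)
    (hφ : IsProperColoring G φ) (v : V) (c : Fin q) {ε : ℝ} (hε : 0 ≤ ε)
    (h : ∀ η η', IsProperColoring G η → IsProperColoring G η' → (∀ u ∈ F, η u = σ u) →
      (∀ u ∈ F', η' u = φ u) →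
      vertexMarginal G (R \ F) η v c ≤ vertexMarginal G (R \ F') η' v c + ε) :
    (p[|agreeOn F σ]).real {τ | τ v = c} ≤ (p[|agreeOn F' φ]).real {τ | τ v = c} + ε := by
  rw [← sub_le_iff_le_add]
  refine hp.le_cond hkq hdeg hFR' hR' hφ v c fun η' hη' hF' => ?_
  rw [sub_le_iff_le_add]
  exact hp.cond_le hkq hdeg hFR hR hσ v c
    (add_nonneg (vertexMarginal_nonneg _ _ _ _ _) hε) fun η hη hF => h η η' hη hη' hF hF'

theorem finite_setOf_walk_length_le {V : Type*} {G : SimpleGraph V} {k : ℕ}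
    (hdeg : ∀ u, (G.neighborSet u).encard ≤ k) (d : ℕ) :
    ∀ v : V, {u | ∃ p : G.Walk v u, p.length ≤ d}.Finite := by
  induction d with
  | zero =>
    intro v
    refine (Set.finite_singleton v).subset ?_
    rintro u ⟨p, hp⟩
    exact (SimpleGraph.Walk.eq_of_length_eq_zero (Nat.le_zero.1 hp)).symm
  | succ d ih =>
    intro v
    have hN : (G.neighborSet v).Finite := Set.finite_of_encard_le_coe (hdeg v)
    refine ((Set.finite_singleton v).union (hN.biUnion fun w _ => ih w)).subset ?_
    rintro u ⟨p, hp⟩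
    cases p with
    | nil => exact Or.inl rfl
    | cons hw p' =>
      right
      simp only [Set.mem_iUnion]
      exact ⟨_, hw, p', by simpa using hp⟩

/-- Conditional probabilities under a Gibbs measure given finitely many colors depend little on
far away colors. -/
theorem IsGibbsMeasure.abs_cond_sub_cond_le (hp : IsGibbsMeasure G p) (hkq : k < q)
    (hdeg : ∀ u, (G.neighborSet u).encard ≤ k) {v : V} {d : ℕ} {ε : ℝ} (hε : 0 ≤ ε)
    (hdecay : ∀ (W W' : Finset V) (η η' : V → Fin q),
      IsProperColoring G η → IsProperColoring G η' → v ∈ W → AgreesWithin G W W' η η' v d →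
      ∀ c, |vertexMarginal G W η v c - vertexMarginal G W' η' v c| ≤ ε)
    {F F' : Finset V} (hv : v ∉ F) {σ φ : V → Fin q} (hσ : IsProperColoring G σ)
    (hφ : IsProperColoring G φ)
    (hag : ∀ u, ∀ w : G.Walk v u, w.length ≤ d → (u ∈ F ↔ u ∈ F') ∧ (u ∈ F → σ u = φ u))
    (c : Fin q) :
    |(p[|agreeOn F σ]).real {τ | τ v = c} - (p[|agreeOn F' φ]).real {τ | τ v = c}| ≤ ε := by
  choose N hN _ using fun u => exists_finset_of_encard_neighborSet_le (hdeg u)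
  set B : Finset V := (finite_setOf_walk_length_le hdeg d v).toFinset with hB
  -- The ball `B` is included so that the vertices pinned within distance `d` of `v` are exactly
  -- those of `F`, respectively `F'`.
  set R : Finset V := B ∪ ((F ∪ F') ∪ (F ∪ F').biUnion N) with hRdef
  have hFR : F ⊆ R := fun u hu => by simp [hRdef, hu]
  have hFR' : F' ⊆ R := fun u hu => by simp [hRdef, hu]
  have hR : ∀ u ∈ F, ∀ w, G.Adj u w → w ∈ R := fun u hu w hw =>
    Finset.mem_union_right _ (Finset.mem_union_right _
      (Finset.mem_biUnion.2 ⟨u, Finset.mem_union_left _ hu, (hN u w).2 hw⟩))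
  have hR' : ∀ u ∈ F', ∀ w, G.Adj u w → w ∈ R := fun u hu w hw =>
    Finset.mem_union_right _ (Finset.mem_union_right _
      (Finset.mem_biUnion.2 ⟨u, Finset.mem_union_right _ hu, (hN u w).2 hw⟩))
  have hball : ∀ u, ∀ w : G.Walk v u, w.length ≤ d → u ∈ R := fun u w hw =>
    Finset.mem_union_left _ (by rw [hB, Set.Finite.mem_toFinset]; exact ⟨w, hw⟩)
  have hvR : v ∈ R \ F :=
    Finset.mem_sdiff.2 ⟨hball v SimpleGraph.Walk.nil (by simp), hv⟩
  have hmain : ∀ η η', IsProperColoring G η → IsProperColoring G η' → (∀ u ∈ F, η u = σ u) →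
      (∀ u ∈ F', η' u = φ u) →
      |vertexMarginal G (R \ F) η v c - vertexMarginal G (R \ F') η' v c| ≤ ε := by
    intro η η' hη hη' hF hF'
    refine hdecay _ _ _ _ hη hη' hvR (fun u w hw => ?_) c
    have huR := hball u w hw
    obtain ⟨h1, h2⟩ := hag u w hw
    refine ⟨by simp [huR, h1], fun hu => ?_⟩
    have huF : u ∈ F := by
      by_contra h
      exact hu (Finset.mem_sdiff.2 ⟨huR, h⟩)
    rw [hF u huF, hF' u (h1.1 huF), h2 huF]
  rw [abs_sub_le_iff]
  constructor
  · have := hp.cond_le_cond_add hkq hdeg hFR hFR' hR hR' hσ hφ v c hε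
      fun η η' hη hη' hF hF' => by
        have := (abs_sub_le_iff.1 (hmain η η' hη hη' hF hF')).1
        linarith
    linarith
  · have := hp.cond_le_cond_add hkq hdeg hFR' hFR hR' hR hφ hσ v c hε
      fun η' η hη' hη hF' hF => by
        have := (abs_sub_le_iff.1 (hmain η η' hη hη' hF hF')).2
        linarith
    linarith

end Gibbs

/-! ### Construction of the regular conditional distribution -/

/-- Integrating elementary conditional probabilities given a finitely valued variable. -/
theorem setLIntegral_cond_fiber {Ω β : Type*} [MeasurableSpace Ω] {p : Measure Ω}
    [IsFiniteMeasure p] [Fintype β] [MeasurableSpace β] [DiscreteMeasurableSpace β] {T : Ω → β}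
    (hT : Measurable T) (S : Set β) (A : Set Ω) :
    ∫⁻ ω in T ⁻¹' S, p[|T ⁻¹' {T ω}] A ∂p = p (T ⁻¹' S ∩ A) := by
  classical
  have hS : MeasurableSet S := .of_discrete
  have hTS := hT hS
  have e1 : ∫⁻ ω in T ⁻¹' S, p[|T ⁻¹' {T ω}] A ∂p
      = ∑ z, S.indicator (fun z => p[|T ⁻¹' {z}] A) z * (p.map T) {z} := by
    rw [← setLIntegral_map (f := fun z => p[|T ⁻¹' {z}] A) hS .of_discrete hT,
      ← lintegral_indicator hS, lintegral_fintype]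
  have e2 : p (T ⁻¹' S ∩ A) = ∑ z, ((p.restrict (T ⁻¹' S ∩ A)).map T) {z} := by
    have := lintegral_fintype (μ := (p.restrict (T ⁻¹' S ∩ A)).map T) (fun _ => 1)
    simp only [lintegral_const, one_mul] at this
    rw [← this, Measure.map_apply hT MeasurableSet.univ]
    simp
  rw [e1, e2]
  refine Finset.sum_congr rfl fun z _ => ?_
  have hz : MeasurableSet (T ⁻¹' {z}) := hT (measurableSet_singleton z)
  rw [Measure.map_apply hT (measurableSet_singleton z),
    Measure.map_apply hT (measurableSet_singleton z), Measure.restrict_apply hz]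
  by_cases hzS : z ∈ S
  · rw [Set.indicator_of_mem hzS, cond_mul_eq_inter hz]
    congr 1
    ext ω
    simp only [Set.mem_inter_iff, Set.mem_preimage, Set.mem_singleton_iff]
    constructor
    · rintro ⟨h1, h2⟩
      exact ⟨h1, h1 ▸ hzS, h2⟩
    · rintro ⟨h1, -, h2⟩
      exact ⟨h1, h2⟩
  · rw [Set.indicator_of_notMem hzS, zero_mul]
    symm
    convert measure_empty (μ := p)
    ext ω
    simp only [Set.mem_inter_iff, Set.mem_preimage, Set.mem_singleton_iff,
      Set.mem_empty_iff_false, iff_false, not_and]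
    intro h1 h2
    exact absurd (h1 ▸ h2) hzS

/-- A function of finitely many discrete coordinates is measurable. -/
theorem measurable_of_eq_of_eqOn_finset {ι α β : Type*} [Finite α] [Nonempty α]
    [MeasurableSpace α] [MeasurableSingletonClass α] [MeasurableSpace β] (F : Finset ι)
    {f : (ι → α) → β} (hf : ∀ η η', (∀ u ∈ F, η u = η' u) → f η = f η') : Measurable f := by
  classical
  let g : (F → α) → β := fun z => f fun u => if h : u ∈ F then z ⟨u, h⟩ else Classical.arbitrary α
  have hfg : f = g ∘ F.restrict := by
    funext η
    exact hf _ _ fun u hu => by simp [hu]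
  rw [hfg]
  exact (Measurable.of_discrete (f := g)).comp (Finset.measurable_restrict F)

/-- A probability vector depending measurably on a parameter, as a kernel. -/
theorem exists_markovKernel_of_weights {α : Type*} [MeasurableSpace α] {q : ℕ}
    {L : Fin q → α → ℝ} (hL : ∀ c, Measurable (L c)) (h0 : ∀ c x, 0 ≤ L c x)
    (h1 : ∀ x, ∑ c, L c x = 1) :
    ∃ κ : Kernel α (Fin q), IsMarkovKernel κ ∧ ∀ x c, κ x {c} = ENNReal.ofReal (L c x) := by
  classical
  let κ : Kernel α (Fin q) :=
    { toFun := fun x => ∑ c, ENNReal.ofReal (L c x) • Measure.dirac c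
      measurable' := by
        refine Measure.measurable_of_measurable_coe _ fun s _ => ?_
        simp only [Measure.coe_finsetSum, Finset.sum_apply, Measure.smul_apply, smul_eq_mul]
        exact Finset.measurable_sum _ fun c _ => (hL c).ennreal_ofReal.mul_const _ }
  have hκ : ∀ x, κ x = ∑ c, ENNReal.ofReal (L c x) • Measure.dirac c := fun x => rfl
  refine ⟨κ, ⟨fun x => ⟨?_⟩⟩, fun x c => ?_⟩
  · rw [hκ]
    simp only [Measure.coe_finsetSum, Finset.sum_apply, Measure.smul_apply, smul_eq_mul,
      measure_univ, mul_one]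
    rw [← ENNReal.ofReal_sum_of_nonneg fun c _ => h0 c x, h1, ENNReal.ofReal_one]
  · rw [hκ]
    simp only [Measure.coe_finsetSum, Finset.sum_apply, Measure.smul_apply, smul_eq_mul]
    rw [Finset.sum_eq_single c]
    · simp
    · intro c' _ hc'
      simp [hc']
    · simp

theorem measure_prod_eq_sum_singleton {α : Type*} [MeasurableSpace α] {q : ℕ}
    (m : Measure (α × Fin q)) {s : Set α} (hs : MeasurableSet s) (t : Set (Fin q)) :
    m (s ×ˢ t) = ∑ c ∈ t.toFinite.toFinset, m (s ×ˢ {c}) := by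
  rw [← measure_biUnion_finset]
  · congr 1
    ext ⟨x, c⟩
    simp
  · intro c _ c' _ hcc'
    exact Set.disjoint_left.2 fun z hz hz' => hcc' (hz.2.symm.trans hz'.2)
  · exact fun c _ => hs.prod (measurableSet_singleton c)

theorem sum_measureReal_eval_eq {V : Type*} {q : ℕ} (μ : Measure (V → Fin q))
    [IsProbabilityMeasure μ] (v : V) : ∑ c, μ.real {τ | τ v = c} = 1 := by
  have hv : Measurable fun τ : V → Fin q => τ v := measurable_pi_apply v
  have h := sum_measureReal_preimage_singleton (μ := μ) (f := fun τ : V → Fin q => τ v)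
    Finset.univ (fun c _ => hv (measurableSet_singleton c))
  rw [Finset.coe_univ, Set.preimage_univ, probReal_univ] at h
  exact h

theorem measurable_restrictTo {V : Type*} {q : ℕ} (U : Set V) :
    Measurable (restrictTo (q := q) U) :=
  measurable_pi_lambda _ fun u => measurable_pi_apply (u : V)

/-- If the elementary conditional probabilities converge at every coloring, their limit is a
regular conditional distribution. -/
theorem exists_isConditionalMarginal {V : Type*} [Countable V] (G : SimpleGraph V) {q : ℕ}
    (hq : 0 < q) (p : Measure (V → Fin q)) [IsProbabilityMeasure p]
    (hproper : ∀ᵐ σ ∂p, IsProperColoring G σ) (v : V) (U : Set V)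
    (hpos : ∀ σ : V → Fin q, IsProperColoring G σ → ∀ F : Finset U,
      p {τ | ∀ u ∈ F, τ (u : V) = σ u} ≠ 0)
    (hconv : ∀ σ : V → Fin q, IsProperColoring G σ → ∀ c,
      ∃ x, Tendsto (fun F : Finset U => finiteCondProb p v U F σ c) atTop (𝓝 x)) :
    ∃ κ : Kernel (U → Fin q) (Fin q), IsConditionalMarginal G p v U κ := by
  classical
  have : Nonempty (Fin q) := ⟨⟨0, hq⟩⟩
  set cyl : Finset U → (U → Fin q) → Set (V → Fin q) :=
    fun F η => {τ | ∀ u ∈ F, τ (u : V) = η u} with hcyl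
  have hcylm : ∀ F η, MeasurableSet (cyl F η) := fun F η => by
    have : cyl F η = ⋂ u ∈ F, (fun τ : V → Fin q => τ u) ⁻¹' {η u} := by
      ext τ; simp [hcyl]
    rw [this]
    exact Finset.measurableSet_biInter F fun u _ =>
      measurable_pi_apply (u : V) (measurableSet_singleton _)
  have hcyleq : ∀ F η η', (∀ u ∈ F, η u = η' u) → cyl F η = cyl F η' := fun F η η' h => by
    ext τ
    exact forall₂_congr fun u hu => by rw [h u hu]
  set pr : Finset U → Fin q → (U → Fin q) → ℝ :=
    fun F c η => (p[|cyl F η]).real {τ | τ v = c} with hpr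
  have hprm : ∀ F c, Measurable (pr F c) := fun F c =>
    measurable_of_eq_of_eqOn_finset F fun η η' h => by simp only [hpr, hcyleq F η η' h]
  -- A measurable set containing the restrictions of all proper colorings, where the limits exist
  -- and no conditioning event is null.
  set good : Set (U → Fin q) := (⋂ c, {η | ∃ x, Tendsto (fun F => pr F c η) atTop (𝓝 x)}) ∩
    ⋂ F, {η | p (cyl F η) ≠ 0} with hgood
  have hgoodm : MeasurableSet good := by
    refine (MeasurableSet.iInter fun c => measurableSet_exists_tendsto fun F => hprm F c).inter
      (MeasurableSet.iInter fun F => ?_)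
    have hm : Measurable fun η => p (cyl F η) :=
      measurable_of_eq_of_eqOn_finset F fun η η' h => by rw [hcyleq F η η' h]
    exact (measurableSet_eq_fun hm measurable_const).compl
  have hgood_proper : ∀ σ, IsProperColoring G σ → restrictTo U σ ∈ good := fun σ hσ =>
    ⟨Set.mem_iInter.2 fun c => hconv σ hσ c, Set.mem_iInter.2 fun F => hpos σ hσ F⟩
  -- Off `good` the value is an arbitrary probability vector, the point mass at color `0`, so that
  -- the limit is a Markov kernel everywhere.
  set f : Finset U → Fin q → (U → Fin q) → ℝ := fun F c η =>
    if η ∈ good then pr F c η else if c = ⟨0, hq⟩ then 1 else 0 with hf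
  have hfm : ∀ F c, Measurable (f F c) := fun F c =>
    Measurable.ite hgoodm (hprm F c) measurable_const
  have hf0 : ∀ F c η, 0 ≤ f F c η := fun F c η => by
    simp only [hf]
    split_ifs <;> first | exact measureReal_nonneg | norm_num
  have hf1 : ∀ F η, ∑ c, f F c η = 1 := fun F η => by
    by_cases h : η ∈ good
    · have hne : p (cyl F η) ≠ 0 := Set.mem_iInter.1 h.2 F
      have := cond_isProbabilityMeasure hne
      simp only [hf, h, if_true]
      exact sum_measureReal_eval_eq _ v
    · simp [hf, h]
  have hlim : ∀ c η, ∃ x, Tendsto (fun F => f F c η) atTop (𝓝 x) := fun c η => by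
    by_cases h : η ∈ good
    · simp only [hf, h, if_true]
      exact Set.mem_iInter.1 h.1 c
    · simp only [hf, h, if_false]
      exact ⟨_, tendsto_const_nhds⟩
  choose L hL using hlim
  have hLm : ∀ c, Measurable (L c) := fun c =>
    measurable_of_tendsto_metrizable' atTop (fun F => hfm F c) (tendsto_pi_nhds.2 (hL c))
  have hL0 : ∀ c η, 0 ≤ L c η := fun c η => ge_of_tendsto' (hL c η) fun F => hf0 F c η
  have hL1 : ∀ η, ∑ c, L c η = 1 := fun η =>
    tendsto_nhds_unique (tendsto_finsetSum Finset.univ fun c _ => hL c η)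
      (by simp only [hf1]; exact tendsto_const_nhds)
  have hLpr : ∀ c, ∀ η ∈ good, Tendsto (fun F => pr F c η) atTop (𝓝 (L c η)) :=
    fun c η h => by simpa only [hf, h, if_true] using hL c η
  obtain ⟨κ, hκM, hκ⟩ := exists_markovKernel_of_weights hLm hL0 hL1
  have hrm := measurable_restrictTo (q := q) U
  refine ⟨κ, hκM, ?_, fun σ hσ c => ?_⟩
  swap
  · rw [Measure.real, hκ, ENNReal.toReal_ofReal (hL0 _ _)]
    exact hLpr c _ (hgood_proper σ hσ)
  have hpmap : IsProbabilityMeasure (p.map fun σ => restrictTo U σ) :=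
    Measure.isProbabilityMeasure_map hrm.aemeasurable
  have hmarg : ∀ c, (p.map fun σ => restrictTo U σ).withDensity
      (fun η => ENNReal.ofReal (L c η)) = (p.restrict {τ | τ v = c}).map (restrictTo U) := by
    intro c
    have hdens : ∀ s, MeasurableSet s → (p.map fun σ => restrictTo U σ).withDensity
        (fun η => ENNReal.ofReal (L c η)) s
        = ∫⁻ σ in restrictTo U ⁻¹' s, ENNReal.ofReal (L c (restrictTo U σ)) ∂p := fun s hs => by
      rw [withDensity_apply _ hs, setLIntegral_map hs (hLm c).ennreal_ofReal hrm]
    have key : ∀ s ∈ measurableCylinders (fun _ : U => Fin q),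
        (p.map fun σ => restrictTo U σ).withDensity (fun η => ENNReal.ofReal (L c η)) s
          = (p.restrict {τ | τ v = c}).map (restrictTo U) s := by
      intro s hs
      have hsm := MeasurableSet.of_mem_measurableCylinders hs
      obtain ⟨F₀, S, hS, rfl⟩ := (mem_measurableCylinders s).1 hs
      rw [hdens _ hsm, Measure.map_apply hrm hsm, Measure.restrict_apply (hrm hsm)]
      -- Once `F` contains the base of the cylinder, the law of total probability makes the integral
      -- independent of `F`.
      have hconst : ∀ F ≥ F₀, ∫⁻ σ in restrictTo U ⁻¹' cylinder F₀ S,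
          ENNReal.ofReal (pr F c (restrictTo U σ)) ∂p
            = p (restrictTo U ⁻¹' cylinder F₀ S ∩ {τ | τ v = c}) := by
        intro F hF
        have hT : Measurable fun (τ : V → Fin q) (u : F) => τ ((u : U) : V) :=
          measurable_pi_lambda _ fun u => measurable_pi_apply _
        have h := setLIntegral_cond_fiber (p := p) hT
          {z | (fun u : F₀ => z ⟨u, hF u.2⟩) ∈ S} {τ | τ v = c}
        have hpre : (fun (τ : V → Fin q) (u : F) => τ ((u : U) : V)) ⁻¹'
            {z | (fun u : F₀ => z ⟨u, hF u.2⟩) ∈ S} = restrictTo U ⁻¹' cylinder F₀ S := rfl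
        rw [hpre] at h
        rw [← h]
        refine lintegral_congr fun τ => ?_
        have hfib : (fun (τ : V → Fin q) (u : F) => τ ((u : U) : V)) ⁻¹'
            {fun u : F => τ ((u : U) : V)} = cyl F (restrictTo U τ) := by
          ext ρ
          simp only [Set.mem_preimage, Set.mem_singleton_iff, funext_iff, hcyl]
          exact ⟨fun h u hu => h ⟨u, hu⟩, fun h u => h u.1 u.2⟩
        rw [hfib]
        exact ofReal_measureReal
      -- Dominated convergence along this net uses that `U` is countable, so that `atTop` on `Finset
      -- U` is countably generated.
      have hdct : Tendsto (fun F : Finset U => ∫⁻ σ in restrictTo U ⁻¹' cylinder F₀ S,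
          ENNReal.ofReal (pr F c (restrictTo U σ)) ∂p) atTop
          (𝓝 (∫⁻ σ in restrictTo U ⁻¹' cylinder F₀ S,
            ENNReal.ofReal (L c (restrictTo U σ)) ∂p)) := by
        refine tendsto_lintegral_filter_of_dominated_convergence (fun _ => 1)
          (Eventually.of_forall fun F => ((hprm F c).comp hrm).ennreal_ofReal)
          (Eventually.of_forall fun F => Eventually.of_forall fun σ => ?_) (by simp) ?_
        · rw [← ENNReal.ofReal_one]
          exact ENNReal.ofReal_le_ofReal measureReal_le_one
        · filter_upwards [ae_restrict_of_ae hproper] with σ hσ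
          exact (ENNReal.continuous_ofReal.tendsto _).comp (hLpr c _ (hgood_proper σ hσ))
      refine tendsto_nhds_unique hdct (tendsto_const_nhds.congr' ?_)
      filter_upwards [eventually_ge_atTop F₀] with F hF
      exact (hconst F hF).symm
    have hfin : IsFiniteMeasure ((p.map fun σ => restrictTo U σ).withDensity
        fun η => ENNReal.ofReal (L c η)) := by
      refine ⟨?_⟩
      rw [key _ (univ_mem_measurableCylinders _)]
      exact measure_lt_top _ _
    exact ext_of_generate_finite _ (generateFrom_measurableCylinders).symm
      isPiSystem_measurableCylinders key (key _ (univ_mem_measurableCylinders _))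
  refine Measure.ext_prod fun {s t} hs ht => ?_
  rw [measure_prod_eq_sum_singleton _ hs, measure_prod_eq_sum_singleton _ hs]
  refine Finset.sum_congr rfl fun c _ => ?_
  rw [Measure.compProd_apply_prod hs (measurableSet_singleton c),
    Measure.map_apply (hrm.prodMk (measurable_pi_apply v)) (hs.prod (measurableSet_singleton c))]
  simp only [hκ]
  rw [← withDensity_apply _ hs, hmarg c, Measure.map_apply hrm hs,
    Measure.restrict_apply (hrm hs)]
  rfl

/-! ### Strong spatial mixing -/

theorem finiteCondProb_eq_cond_agreeOn {V : Type*} {q : ℕ} (p : Measure (V → Fin q)) (v : V)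
    (U : Set V) (F : Finset U) (σ : V → Fin q) (c : Fin q) :
    finiteCondProb p v U F σ c
      = (p[|agreeOn (F.map (Function.Embedding.subtype _)) σ]).real {τ | τ v = c} := by
  have : {τ : V → Fin q | ∀ u ∈ F, τ (u : V) = σ u}
      = agreeOn (F.map (Function.Embedding.subtype _)) σ := by
    ext τ
    simp [agreeOn]
  rw [finiteCondProb, this]

theorem countable_of_connected {V : Type*} {G : SimpleGraph V} {k : ℕ}
    (hdeg : ∀ u, (G.neighborSet u).encard ≤ k) (hG : G.Connected) : Countable V := by
  obtain ⟨v⟩ := hG.nonempty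
  have h : (⋃ d : ℕ, {u | ∃ p : G.Walk v u, p.length ≤ d}) = Set.univ :=
    Set.eq_univ_of_forall fun u => by
      obtain ⟨p⟩ := hG.preconnected v u
      exact Set.mem_iUnion.2 ⟨p.length, p, le_rfl⟩
  rw [← Set.countable_univ_iff, ← h]
  exact Set.countable_iUnion fun d => (finite_setOf_walk_length_le hdeg d v).countable

/-- Exponential decay of finite-volume correlations yields strong spatial mixing. -/
theorem IsGibbsMeasure.strongSpatialMixing {V : Type*} {G : SimpleGraph V} {k q : ℕ}
    {p : Measure (V → Fin q)} (hp : IsGibbsMeasure G p) (hkq : k < q)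
    (hdeg : ∀ u, (G.neighborSet u).encard ≤ k) (hG : G.Connected) {C θ : ℝ} (hC : 0 < C)
    (hθ0 : 0 < θ) (hθ1 : θ < 1)
    (hdecay : ∀ (v : V) (W W' : Finset V) (η η' : V → Fin q) (d : ℕ),
      IsProperColoring G η → IsProperColoring G η' → v ∈ W → AgreesWithin G W W' η η' v d →
      ∀ c, |vertexMarginal G W η v c - vertexMarginal G W' η' v c| ≤ C * θ ^ d) :
    StrongSpatialMixing G p fun d => q * (C / θ) * θ ^ d := by
  classical
  intro v U hvU
  have := hp.isProbabilityMeasure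
  have := countable_of_connected hdeg hG
  have hvF : ∀ F : Finset U, v ∉ F.map (Function.Embedding.subtype _) := fun F h => by
    obtain ⟨u, -, hu⟩ := Finset.mem_map.1 h
    exact hvU (hu ▸ u.2)
  have hmem : ∀ (F : Finset U) (u : V),
      u ∈ F.map (Function.Embedding.subtype _) ↔ ∃ h : u ∈ U, (⟨u, h⟩ : U) ∈ F := fun F u => by
    simp
  have hconv : ∀ σ : V → Fin q, IsProperColoring G σ → ∀ c,
      ∃ x, Tendsto (fun F : Finset U => finiteCondProb p v U F σ c) atTop (𝓝 x) := by
    intro σ hσ c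
    refine cauchySeq_tendsto_of_complete (Metric.cauchySeq_iff'.2 fun ε hε => ?_)
    obtain ⟨d, hd⟩ := exists_pow_lt_of_lt_one (div_pos hε hC) hθ1
    rw [lt_div_iff₀ hC, mul_comm] at hd
    -- Beyond the finite set of vertices of `U` within distance `d`, enlarging `F` changes the
    -- probability by at most `C * θ ^ d`.
    have hfin : {u : U | ∃ w : G.Walk v u, w.length ≤ d}.Finite :=
      (finite_setOf_walk_length_le hdeg d v).preimage Subtype.val_injective.injOn
    refine ⟨hfin.toFinset, fun F hF => ?_⟩
    rw [Real.dist_eq, finiteCondProb_eq_cond_agreeOn, finiteCondProb_eq_cond_agreeOn]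
    refine (hp.abs_cond_sub_cond_le hkq hdeg (by positivity)
      (fun W W' η η' => hdecay v W W' η η' d) (hvF F) hσ hσ (fun u w hw => ⟨?_, fun _ => rfl⟩)
      c).trans_lt hd
    rw [hmem, hmem]
    exact exists_congr fun h =>
      ⟨fun _ => hfin.mem_toFinset.2 ⟨w, hw⟩, fun h' => hF h'⟩
  obtain ⟨κ, hκ⟩ := exists_isConditionalMarginal G (by omega) p hp.ae_proper v U
    (fun σ hσ F => by
      have h := hp.measure_agreeOn_ne_zero hkq hdeg (F.map (Function.Embedding.subtype _)) hσ
      have e : {τ : V → Fin q | ∀ u ∈ F, τ (u : V) = σ u}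
          = agreeOn (F.map (Function.Embedding.subtype _)) σ := by
        ext τ
        simp [agreeOn]
      rwa [e]) hconv
  refine ⟨κ, hκ, fun σ φ hσ hφ => ?_⟩
  rcases Set.eq_empty_or_nonempty (disagreement U σ φ) with hD | hD
  · have e : restrictTo U σ = restrictTo U φ := by
      funext u
      by_contra h
      have : (u : V) ∈ disagreement U σ φ := ⟨u.2, h⟩
      rw [hD] at this
      exact this
    rw [e]
    simp only [sub_self, abs_zero, Finset.sum_const_zero]
    positivity
  -- As `v ∉ U` the distance is positive. Disagreement at distance `n + 1` means agreement within
  -- `n`, whence the `C / θ`; the factor `q` comes from summing over colors.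
  · obtain ⟨n, hn⟩ : ∃ n, distToSet G v (disagreement U σ φ) = n + 1 := by
      refine Nat.exists_eq_succ_of_ne_zero fun h0 => ?_
      obtain ⟨u, hu, hu0⟩ := Nat.sInf_mem (hD.image (G.dist v))
      change sInf (G.dist v '' disagreement U σ φ) = 0 at h0
      rw [h0, hG.dist_eq_zero_iff] at hu0
      exact hvU (hu0 ▸ hu.1)
    have hfar : ∀ u, ∀ w : G.Walk v u, w.length ≤ n → u ∈ U → σ u = φ u := by
      intro u w hw hu
      by_contra hne
      have h1 : distToSet G v (disagreement U σ φ) ≤ G.dist v u :=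
        Nat.sInf_le ⟨u, ⟨hu, hne⟩, rfl⟩
      have h2 := SimpleGraph.dist_le w
      omega
    have hterm : ∀ c, |(κ (restrictTo U σ)).real {c} - (κ (restrictTo U φ)).real {c}|
        ≤ C * θ ^ n := fun c => by
      refine le_of_tendsto' ((hκ.pointwise σ hσ c).sub (hκ.pointwise φ hφ c)).abs fun F => ?_
      rw [finiteCondProb_eq_cond_agreeOn, finiteCondProb_eq_cond_agreeOn]
      refine hp.abs_cond_sub_cond_le hkq hdeg (by positivity)
        (fun W W' η η' => hdecay v W W' η η' n) (hvF F) hσ hφ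
        (fun u w hw => ⟨Iff.rfl, fun hu => ?_⟩) c
      exact hfar u w hw ((hmem F u).1 hu).1
    rw [hn]
    calc _ ≤ ∑ _c : Fin q, C * θ ^ n := Finset.sum_le_sum fun c _ => hterm c
      _ = q * (C / θ) * θ ^ (n + 1) := by
        rw [Finset.sum_const, Finset.card_univ, Fintype.card_fin, nsmul_eq_mul, pow_succ]
        field_simp

theorem theorem1 (b : ℕ) (hb : 1 ≤ b) (c : ℝ) (hc : c = Real.exp (1 / c))
    (q : ℕ) (hq : 1 + ⌈c * (b : ℝ)⌉₊ ≤ q) :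
    ∃ C a : ℝ, 0 < C ∧ 0 < a ∧
      ∀ (V : Type*) (G : SimpleGraph V) [G.LocallyFinite],
        G.IsTree → G.IsRegularOfDegree (b + 1) →
        ∀ p : Measure (V → Fin q), IsGibbsMeasure G p →
          StrongSpatialMixing G p (fun d : ℕ => C * Real.exp (-a * (d : ℝ))) := by
  -- The constant `c` enters only through `c ≥ 7/4`.
  have hq4 : 7 * b + 4 ≤ 4 * q := by
    have h1 := Nat.le_ceil (c * (b : ℝ))
    have h2 : (1 : ℝ) + (⌈c * (b : ℝ)⌉₊ : ℝ) ≤ q := by exact_mod_cast hq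
    have h3 := mul_le_mul_of_nonneg_right (seven_quarters_le_of_eq_exp_inv c hc)
      (Nat.cast_nonneg (α := ℝ) b)
    have h4 : 7 * (b : ℝ) + 4 ≤ 4 * q := by linarith
    exact_mod_cast h4
  obtain ⟨C, hC, hdecay⟩ := exists_abs_vertexMarginal_sub_le hb hq4
  have hθ0 : 0 < √(99 / 100 : ℝ) := Real.sqrt_pos.2 (by norm_num)
  have hθ1 : √(99 / 100 : ℝ) < 1 := by
    rw [Real.sqrt_lt' one_pos]; norm_num
  have hq0 : (0 : ℝ) < q := by
    have : 0 < q := by omega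
    exact_mod_cast this
  -- With `a = -log θ` the exponential rate is exactly `θ ^ d`.
  refine ⟨q * (C / √(99 / 100)), -Real.log √(99 / 100), by positivity,
    neg_pos.2 (Real.log_neg hθ0 hθ1), fun V G _ hG hreg p hp => ?_⟩
  have hdeg : ∀ u, (G.neighborSet u).encard ≤ ((b + 1 : ℕ) : ℕ∞) := fun u => by
    rw [Set.encard_eq_coe_toFinset_card]
    exact_mod_cast (hreg u).le
  have hrate : (fun d : ℕ => q * (C / √(99 / 100)) *
      Real.exp (-(-Real.log √(99 / 100)) * (d : ℝ)))
      = fun d : ℕ => q * (C / √(99 / 100)) * √(99 / 100) ^ d := by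
    funext d
    rw [neg_neg, mul_comm (Real.log _), Real.exp_nat_mul, Real.exp_log hθ0]
  rw [hrate]
  exact hp.strongSpatialMixing (by omega) hdeg hG.connected hC hθ0 hθ1
    fun v W W' η η' d => hdecay V G hG.isAcyclic (by exact_mod_cast hdeg) v W W' η η' d
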